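/- Let \(n\ge 0\) and let \(j_1,\dots,j_m\ge 1\) be integers with \(j_1+\dots+j_m=n\). Let \(Z_1,\dots,Z_n\) be independent standard quaternion Gaussian random variables, that is, \(Z=\xi_0+i\xi_1+j\xi_2+k\xi_3\) with independent real \(N(0,1)\) variables \(\xi_0,\dots,\xi_3\). Let each of \(X_{\pm1},\dots,X_{\pm n}\) be one of \(Z_1,\dots,Z_n\) (repetitions allowed, no conjugates): \(X_a=Z_{t(a)}\) for a function \(t:\{\pm1,\dots,\pm n\}\to\{1,\dots,n\}\). Put \(\beta_0=0\) and \(\beta_k=j_1+\dots+j_k\). On \(\{\pm1,\dots,\pm n\}\) let \(\delta\) be the pair partition with pairs \(\{i,-i\}\), and let \(\sigma\) be the pair partition with pairs \(\{i,-(i+1)\}\) for \(\beta_{k-1}<i<\beta_k\) and \(\{\beta_k,-(\beta_{k-1}+1)\}\), for \(k=1,\dots,m\). For each pair partition \(\gamma\) of \(\{\pm1,\dots,\pm n\}\) such that \(t(a)=t(b)\) for all \(\{a,b\}\in\gamma\), define a bipartite Möbius graph \(\Gamma\) (a ribbon graph whose ribbons may be flipped) with \(n\) labelled ribbons as follows.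 Its black vertices are disks, one for each of the \(m\) cycles of \(\delta\cup\sigma\), and its white vertices are disks, one for each cycle of \(\delta\cup\gamma\). Along the boundary of each disk, lines labelled by the elements of the cycle are drawn in the cyclic order of the cycle. The adjacent lines \(-i,i\) at a black vertex and the adjacent lines \(-i,i\) at a white vertex are the two ends of the \(i\)-th ribbon; its sides join lines with equal labels. (So the ribbon is flipped if the order of \(-i,i\) on the two oriented disks does not match; graphs that differ only in the choice of orientation of white vertices are identified.) The faces of \(\Gamma\) are the cycles obtained by following the sides of ribbons and passing, along the boundary of a vertex disk, to the adjacent side of the neighbouring ribbon. Let \(\chi(\Gamma)=v(\Gamma)-e(\Gamma)+f(\Gamma)\), where \(v,e,f\) are the numbers of vertices (black and white), ribbons and faces. Let \(\mathcal M\) be the set of all these graphs \(\Gamma\). Then the product below is integrable, and \[ \mathbb{E}\Big(\prod_{k=1}^{m}\Re\big(\overline{X}_{-(\beta_{k-1}+1)}X_{\beta_{k-1}+1}\,\overline{X}_{-(\beta_{k-1}+2)}X_{\beta_{k-1}+2}\cdots\overline{X}_{-\beta_k}X_{\beta_k}\big)\Big)=4^{\,n-m}\sum_{\Gamma\in\mathcal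 M}(-2)^{\chi(\Gamma)}, \] where the right-hand side is \(0\) if \(\mathcal M=\emptyset\). -/

import Mathlib

open MeasureTheory ProbabilityTheory
open scoped Quaternion

/-! ### Quaternion Gaussian variables -/

/-- The Borel sigma-algebra of the quaternions. -/
noncomputable instance quaternionMeasurableSpace : MeasurableSpace ℍ[ℝ] := borel ℍ[ℝ]

instance quaternionBorelSpace : BorelSpace ℍ[ℝ] := ⟨rfl⟩

/-- `Z` is a standard quaternion Gaussian variable: `Z = ξ₀ + i ξ₁ + j ξ₂ + k ξ₃` with
independent real `N(0,1)` variables `ξ₀, ξ₁, ξ₂, ξ₃`. -/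
def IsQuaternionGaussian {Ω : Type*} [MeasurableSpace Ω] (Z : Ω → ℍ[ℝ]) (μ : Measure Ω) : Prop :=
  ∃ ξ : Fin 4 → Ω → ℝ,
    (∀ i, HasLaw (ξ i) (gaussianReal 0 1) μ) ∧ iIndepFun ξ μ ∧
      ∀ ω, Z ω = ⟨ξ 0 ω, ξ 1 ω, ξ 2 ω, ξ 3 ω⟩

/-! ### Möbius graphs -/

/-- A pair partition of `α`, encoded by the map that sends each element to its partner. -/
def IsPairing {α : Type*} (p : Equiv.Perm α) : Prop :=
  (∀ a, p (p a) = a) ∧ ∀ a, p a ≠ a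

/-- The number of cycles of the 2-regular graph `p ∪ q` formed by two pair partitions
(more generally, the number of orbits of the group generated by `p` and `q`). -/
noncomputable def cycleCount {α : Type*} (p q : Equiv.Perm α) : ℕ :=
  Nat.card (MulAction.orbitRel.Quotient (Subgroup.closure ({p, q} : Set (Equiv.Perm α))) α)

/-- A Möbius graph (a ribbon graph whose ribbons may be flipped) without isolated vertices, on a
set `L` of lines. Every ribbon has two ends and, at each of its ends, two lines: the beginnings of
its two sides. So each ribbon carries four lines.

* `across` exchanges the two lines at the same end of a ribbon,
* `along` follows the side of a ribbon from one end to the other,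
* `corner` follows the boundary circle of a vertex disk from a line to the adjacent line of the
  neighbouring ribbon.

A choice of orientation of the boundary circles of the vertex disks presents this as a system of
oriented disks with ribbons, where a ribbon is flipped if its sides reverse the chosen
orientations. Changing the orientation at a vertex, and with it the flips of the ribbons at
this vertex, presents the same `across`, `along` and `corner`. -/
@[ext]
structure MobiusGraph (L : Type*) where
  across : Equiv.Perm L
  along : Equiv.Perm L
  corner : Equiv.Perm L
  across_pairing : IsPairing across
  along_pairing : IsPairing along
  corner_pairing : IsPairing corner
  along_across : ∀ l, along (across l) = across (along l)
  along_across_ne : ∀ l, along (across l) ≠ l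

namespace MobiusGraph

variable {L : Type*}

/-- The number of vertices: boundary circles of the vertex disks. -/
noncomputable def v (Γ : MobiusGraph L) : ℕ := cycleCount Γ.across Γ.corner

/-- The number of edges (ribbons). -/
noncomputable def e (Γ : MobiusGraph L) : ℕ := cycleCount Γ.across Γ.along

/-- The number of faces: cycles of sides of ribbons, found by following the sides of the ribbons
and turning at the corners of the vertices. -/
noncomputable def f (Γ : MobiusGraph L) : ℕ := cycleCount Γ.along Γ.corner

/-- The Euler characteristic. -/
noncomputable def eulerChar (Γ : MobiusGraph L) : ℤ := (Γ.v : ℤ) - Γ.e + Γ.f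

instance [Finite L] : Finite (MobiusGraph L) :=
  Finite.of_injective (fun Γ : MobiusGraph L => (Γ.across, Γ.along, Γ.corner)) fun Γ Γ' h => by
    simp only [Prod.mk.injEq] at h
    exact MobiusGraph.ext h.1 h.2.1 h.2.2

end MobiusGraph

/-! ### The pair partitions and the bipartite Möbius graphs -/

/-- The set `{±1, …, ±n}`: `(i, true)` stands for the positive index `i + 1` and `(i, false)`
for the negative index `-(i + 1)`, where `i = 0, …, n - 1`. -/
abbrev SignedIndex (n : ℕ) : Type := Fin n × Bool

/-- The pair partition `δ`, with the pairs `{j, -j}`. -/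
def deltaPairing (n : ℕ) : Equiv.Perm (SignedIndex n) where
  toFun a := (a.1, !a.2)
  invFun a := (a.1, !a.2)
  left_inv a := by simp
  right_inv a := by simp

/-- The cyclic successor of an index inside its block of the decomposition
`{1, …, n} = {1, …, j₁} ∪ {j₁ + 1, …, j₁ + j₂} ∪ ⋯`, where `c = (j₁, …, j_m)`: the permutation
`(1, …, j₁)(j₁ + 1, …, j₁ + j₂)⋯`. -/
def nextInBlock {n : ℕ} (c : Composition n) : Equiv.Perm (Fin n) :=
  c.blocksFinEquiv.permCongr (Equiv.sigmaCongrRight fun k => finRotate (c.blocksFun k))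

/-- The pair partition `σ`, with the pairs `{i, -i'}` where `i'` is the cyclic successor of `i`
in its block. -/
def sigmaPairing {n : ℕ} (c : Composition n) : Equiv.Perm (SignedIndex n) where
  toFun a := match a with
    | (i, true) => (nextInBlock c i, false)
    | (i, false) => ((nextInBlock c).symm i, true)
  invFun a := match a with
    | (i, true) => (nextInBlock c i, false)
    | (i, false) => ((nextInBlock c).symm i, true)
  left_inv := by rintro ⟨i, _ | _⟩ <;> simp
  right_inv := by rintro ⟨i, _ | _⟩ <;> simp

theorem isPairing_delta (n : ℕ) : IsPairing (deltaPairing n) := by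
  refine ⟨fun a => by simp [deltaPairing], fun a h => ?_⟩
  have := congrArg Prod.snd h
  simp [deltaPairing] at this

theorem isPairing_sigma {n : ℕ} (c : Composition n) : IsPairing (sigmaPairing c) := by
  refine ⟨(sigmaPairing c).left_inv, ?_⟩
  rintro ⟨i, _ | _⟩ h <;> simp [sigmaPairing] at h

theorem IsPairing.sumCongr {α β : Type*} {p : Equiv.Perm α} {q : Equiv.Perm β}
    (hp : IsPairing p) (hq : IsPairing q) : IsPairing (Equiv.sumCongr p q) := by
  constructor
  · rintro (a | a) <;> simp [hp.1, hq.1]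
  · rintro (a | a) <;> simp [hp.2, hq.2]

/-- The lines of a bipartite Möbius graph with `n` ribbons: `Sum.inl a` is the line labelled
`a ∈ {±1, …, ±n}` at a black vertex, `Sum.inr a` is the line labelled `a` at a white vertex. -/
abbrev Line (n : ℕ) : Type := SignedIndex n ⊕ SignedIndex n

/-- The bipartite Möbius graph of the pair partitions `δ`, `σ` and `γ`: the black vertices are the
cycles of `δ ∪ σ`, the white vertices are the cycles of `δ ∪ γ`, the lines labelled `j`, `-j` at
a vertex are the two lines of a ribbon, and each line at a black vertex is connected to the
line at a white vertex that has the same label. -/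
def bipartiteMobiusGraph {n : ℕ} (c : Composition n) (γ : Equiv.Perm (SignedIndex n))
    (hγ : IsPairing γ) : MobiusGraph (Line n) where
  across := Equiv.sumCongr (deltaPairing n) (deltaPairing n)
  along := Equiv.sumComm (SignedIndex n) (SignedIndex n)
  corner := Equiv.sumCongr (sigmaPairing c) γ
  across_pairing := (isPairing_delta n).sumCongr (isPairing_delta n)
  along_pairing := by constructor <;> rintro (a | a) <;> simp
  corner_pairing := (isPairing_sigma c).sumCongr hγ
  along_across := by rintro (a | a) <;> simp
  along_across_ne := by rintro (a | a) <;> simp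

/-- The set of all bipartite Möbius graphs that come from the ways to pair equal variables in the
sequence `X_{±1}, …, X_{±n}`, where `X_a = Z_{t a}`. -/
noncomputable def bipartiteMobiusGraphs {n : ℕ} {ι : Type*} (c : Composition n)
    (t : SignedIndex n → ι) : Finset (MobiusGraph (Line n)) :=
  (Set.toFinite {Γ : MobiusGraph (Line n) |
    ∃ (γ : Equiv.Perm (SignedIndex n)) (hγ : IsPairing γ),
      (∀ a, t (γ a) = t a) ∧ Γ = bipartiteMobiusGraph c γ hγ}).toFinset

section Cycles

variable {α : Type*}

/-! ### Counting cycles by invariant and by alternating functions -/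

/-! Quaternions act on `ℂ²`, and the real part is half of the trace. Expanding the traces gives each
line two binary indices: `y`, which alternates along the pairs of `δ`, and `z`, which alternates
along the pairs of `σ`. A conjugate contributes a sign and a matrix entry of the unconjugated
quaternion with its indices transposed and flipped (`prod_re_eq_sum_alternates`).

Wick's formula for the real coordinates (`integral_prod_quaternionCoord`) turns the expectation into
a sum over the pairings `γ` that respect `t`. For fixed `γ`, the completeness relation of the
quaternion units (`sum_unitMatrix_mul_unitMatrix`) forces `y` and `z` to alternate along `γ` as
well, and gives each pair the factor `2` or `-2`. Alternating functions are two-colourings of the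
cycles, so there are `2 ^ cycleCount δ γ` choices of `y` and `2 ^ cycleCount σ γ` choices of `z`.

The crux is that the total sign does not depend on these choices. An alternating function orients
every pair, and the number of pairs on which two orientations differ is the parity of the
permutation that swaps exactly these pairs. For the three pairings taken cyclically,
`sign_reorient_mul` evaluates the product of the three signs as a power of `-1` in the three cycle
numbers. Each cycle of `δ ∪ γ` and of `σ ∪ γ` thus has weight `-2`. These cycles are the white
vertices and the faces, and the remaining constants combine to `4 ^ (n - m)` and the rest of the
Euler characteristic. -/

theorem eq_of_mem_closure_pair {β : Type*} {p q : Equiv.Perm α} {h : α → β}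
    (hp : ∀ a, h (p a) = h a) (hq : ∀ a, h (q a) = h a) {g : Equiv.Perm α}
    (hg : g ∈ Subgroup.closure ({p, q} : Set (Equiv.Perm α))) (a : α) : h (g a) = h a := by
  induction hg using Subgroup.closure_induction generalizing a with
  | mem x hx =>
    rcases hx with rfl | rfl
    · exact hp a
    · exact hq a
  | one => rfl
  | mul x y _ _ hx hy => rw [Equiv.Perm.mul_apply, hx, hy]
  | inv x _ hx => simpa using (hx (x⁻¹ a)).symm

theorem mem_closure_pair_left (p q : Equiv.Perm α) :
    p ∈ Subgroup.closure ({p, q} : Set (Equiv.Perm α)) :=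
  Subgroup.subset_closure (Set.mem_insert _ _)

theorem mem_closure_pair_right (p q : Equiv.Perm α) :
    q ∈ Subgroup.closure ({p, q} : Set (Equiv.Perm α)) :=
  Subgroup.subset_closure (Set.mem_insert_of_mem _ rfl)

/-- Functions on the set of cycles of `p ∪ q` are the functions that `p` and `q` preserve. -/
noncomputable def invariantEquiv (p q : Equiv.Perm α) (β : Type*) :
    {h : α → β // (∀ a, h (p a) = h a) ∧ ∀ a, h (q a) = h a} ≃
      (MulAction.orbitRel.Quotient (Subgroup.closure ({p, q} : Set (Equiv.Perm α))) α → β) where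
  toFun h := Quotient.lift h.1 (by
    rintro a b ⟨⟨g, hg⟩, rfl⟩
    exact eq_of_mem_closure_pair h.2.1 h.2.2 hg b)
  invFun k := ⟨fun a => k (Quotient.mk _ a),
    fun a => congrArg k (Quotient.sound ⟨⟨p, mem_closure_pair_left p q⟩, rfl⟩),
    fun a => congrArg k (Quotient.sound ⟨⟨q, mem_closure_pair_right p q⟩, rfl⟩)⟩
  left_inv h := rfl
  right_inv k := by
    funext x
    induction x using Quotient.inductionOn
    rfl

/-- This turns cycle counting into counting invariant Boolean functions: cycle numbers are compared
below through bijections of such functions and injectivity of `2 ^ ·`. -/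
theorem card_invariant [Finite α] (p q : Equiv.Perm α) :
    Nat.card {h : α → Bool // (∀ a, h (p a) = h a) ∧ ∀ a, h (q a) = h a} =
      2 ^ cycleCount p q := by
  have : Finite (MulAction.orbitRel.Quotient
    (Subgroup.closure ({p, q} : Set (Equiv.Perm α))) α) := Quotient.finite _
  rw [Nat.card_congr (invariantEquiv p q Bool), Nat.card_fun, cycleCount]
  simp

/-- The function `x` takes different values on the elements of each pair of `p`. -/
def Alternates (x : α → Bool) (p : Equiv.Perm α) : Prop := ∀ a, x (p a) = !x a

/-- Conjugation by `p` inverts `q * p`, a dihedral relation. If a power of `q * p` sent `a` to `p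
a`, then halfway along this walk `p` (even exponent) or `q` (odd exponent) would have a fixed point.
-/
theorem IsPairing.zpow_apply_ne {p q : Equiv.Perm α} (hp : IsPairing p) (hq : IsPairing q)
    (a : α) (i : ℤ) : ((q * p) ^ i) a ≠ p a := by
  have hpp : p * p = 1 := Equiv.ext hp.1
  have hqq : q * q = 1 := Equiv.ext hq.1
  have hpi : p⁻¹ = p := inv_eq_of_mul_eq_one_left hpp
  have hqi : q⁻¹ = q := inv_eq_of_mul_eq_one_left hqq
  have hconj : ∀ k : ℤ, p * (q * p) ^ k = (q * p) ^ (-k) * p := by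
    intro k
    have h1 : p * (q * p) * p⁻¹ = (q * p)⁻¹ := by
      rw [mul_inv_rev, hpi, hqi, mul_assoc, mul_assoc, hpp, mul_one]
    rw [zpow_neg, ← inv_zpow, ← h1, conj_zpow, inv_mul_cancel_right]
  intro h
  rcases Int.even_or_odd' i with ⟨k, rfl | rfl⟩
  · apply hp.2 (((q * p) ^ k) a)
    rw [← Equiv.Perm.mul_apply, hconj, Equiv.Perm.mul_apply, ← h, ← Equiv.Perm.mul_apply,
      ← zpow_add]
    congr 2; ring
  · apply hq.2 (p (((q * p) ^ k) a))
    have h1 : q (p (((q * p) ^ k) a)) = ((q * p) ^ (k + 1)) a := by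
      rw [add_comm, zpow_add, zpow_one]; rfl
    rw [h1, ← Equiv.Perm.mul_apply p, hconj, Equiv.Perm.mul_apply, ← h, ← Equiv.Perm.mul_apply,
      ← zpow_add]
    congr 2; ring

/-- The cycles of `p ∪ q` have even length: each splits into two orbits of `q * p`, which `p` and
`q` exchange. The colour `true` goes to the orbit of a chosen representative of the cycle. -/
theorem exists_alternates {p q : Equiv.Perm α} (hp : IsPairing p) (hq : IsPairing q) :
    ∃ x : α → Bool, Alternates x p ∧ Alternates x q := by
  classical
  let G := Subgroup.closure ({p, q} : Set (Equiv.Perm α))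
  let r : α → α := fun a => (Quotient.mk (MulAction.orbitRel G α) a).out
  have hrp : ∀ a, r (p a) = r a := fun a => congrArg Quotient.out
    (Quotient.sound ⟨⟨p, mem_closure_pair_left p q⟩, rfl⟩)
  have hrq : ∀ a, r (q a) = r a := fun a => congrArg Quotient.out
    (Quotient.sound ⟨⟨q, mem_closure_pair_right p q⟩, rfl⟩)
  have hcover : ∀ a, (q * p).SameCycle (r a) a ∨ (q * p).SameCycle (r a) (p a) := by
    intro a
    obtain ⟨⟨g, hg⟩, hga⟩ : (MulAction.orbitRel G α) a (r a) :=
      (MulAction.orbitRel G α).symm (Quotient.mk_out a)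
    have hga : g (r a) = a := hga
    -- The property "`b` or `p b` lies in the `q * p`-orbit of `s`" is preserved by both `p` and
    -- `q`, hence by the whole group.
    have key : ∀ s b : α, ((q * p).SameCycle s (g b) ∨ (q * p).SameCycle s (p (g b))) =
        ((q * p).SameCycle s b ∨ (q * p).SameCycle s (p b)) := by
      intro s
      refine eq_of_mem_closure_pair
        (h := fun b => (q * p).SameCycle s b ∨ (q * p).SameCycle s (p b)) ?_ ?_ hg
      · intro b
        simp only [hp.1]
        exact propext or_comm
      · intro b
        have h1 : (q * p).SameCycle s (q b) ↔ (q * p).SameCycle s (p b) := by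
          rw [← Equiv.Perm.sameCycle_apply_right (f := q * p) (y := p b)]
          simp [hp.1]
        have h2 : (q * p).SameCycle s (p (q b)) ↔ (q * p).SameCycle s b := by
          rw [← Equiv.Perm.sameCycle_apply_right (f := q * p) (y := p (q b))]
          simp [hp.1, hq.1]
        simp only [h1, h2]
        exact propext or_comm
    have := key (r a) (r a)
    rw [hga] at this
    rw [this]
    exact Or.inl (Equiv.Perm.SameCycle.refl _ _)
  have hdisj : ∀ a, ¬ ((q * p).SameCycle (r a) a ∧ (q * p).SameCycle (r a) (p a)) := by
    rintro a ⟨h1, h2⟩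
    obtain ⟨i, hi⟩ := h1.symm.trans h2
    exact hp.zpow_apply_ne hq a i hi
  have hxp : Alternates (fun a => decide ((q * p).SameCycle (r a) a)) p := by
    intro a
    have h1 := hcover a
    have h2 := hdisj a
    simp only [hrp]
    by_cases h3 : (q * p).SameCycle (r a) a <;> simp_all
  refine ⟨_, hxp, fun a => ?_⟩
  rw [← hxp a]
  have h1 : (q * p).SameCycle (r a) (q a) ↔ (q * p).SameCycle (r a) (p a) := by
    rw [← Equiv.Perm.sameCycle_apply_right (f := q * p) (y := p a)]
    simp [hp.1]
  simp only [hrp, hrq, h1]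

/-- The alternating functions form a torsor under the invariant ones: `xor` with one fixed
alternating function exchanges the two kinds. -/
theorem card_alternates [Finite α] {p q : Equiv.Perm α} (hp : IsPairing p) (hq : IsPairing q) :
    Nat.card {x : α → Bool // Alternates x p ∧ Alternates x q} = 2 ^ cycleCount p q := by
  obtain ⟨x₀, h₀p, h₀q⟩ := exists_alternates hp hq
  rw [← card_invariant]
  refine Nat.card_congr
    { toFun := fun x => ⟨fun a => xor (x.1 a) (x₀ a), fun a => ?_, fun a => ?_⟩
      invFun := fun h => ⟨fun a => xor (h.1 a) (x₀ a), fun a => ?_, fun a => ?_⟩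
      left_inv := fun x => ?_
      right_inv := fun h => ?_ }
  · simp [x.2.1 a, h₀p a]
  · simp [x.2.2 a, h₀q a]
  · simp [h.2.1 a, h₀p a]
  · simp [h.2.2 a, h₀q a]
  · ext a; simp
  · ext a; simp

theorem cycleCount_eq_of_surjective {β : Type*} {p q : Equiv.Perm α} {F : α → β}
    (hF : Function.Surjective F)
    (h : ∀ a b, F a = F b ↔
      ∃ g ∈ Subgroup.closure ({p, q} : Set (Equiv.Perm α)), g b = a) :
    cycleCount p q = Nat.card β := by
  rw [cycleCount]
  refine Nat.card_congr (Equiv.ofBijective (Quotient.lift F ?_) ⟨?_, ?_⟩)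
  · rintro a b ⟨⟨g, hg⟩, hab⟩
    exact (h a b).2 ⟨g, hg, hab⟩
  · intro x y
    induction x using Quotient.inductionOn with | h a => ?_
    induction y using Quotient.inductionOn with | h b => ?_
    intro hab
    obtain ⟨g, hg, hab⟩ := (h a b).1 hab
    exact Quotient.sound ⟨⟨g, hg⟩, hab⟩
  · intro y
    obtain ⟨a, rfl⟩ := hF y
    exact ⟨Quotient.mk _ a, rfl⟩

/-- `cycleCount f f` is the number of orbits of `f`, fixed points included, and a cycle of length
`l` has sign `(-1) ^ (l - 1)`. -/
theorem sign_eq_neg_one_pow_cycleCount [Fintype α] [DecidableEq α] (f : Equiv.Perm α) :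
    Equiv.Perm.sign f = (-1) ^ (Fintype.card α + cycleCount f f) := by
  have hc : cycleCount f f =
      Nat.card (f.cycleFactorsFinset ⊕ {a : α // f a = a}) := by
    let F : α → f.cycleFactorsFinset ⊕ {a : α // f a = a} := fun a =>
      if h : f a = a then Sum.inr ⟨a, h⟩
      else Sum.inl ⟨f.cycleOf a, Equiv.Perm.cycleOf_mem_cycleFactorsFinset_iff.2
        (Equiv.Perm.mem_support.2 h)⟩
    refine cycleCount_eq_of_surjective (F := F) ?_ ?_
    · rintro (⟨c, hc⟩ | ⟨a, ha⟩)
      · obtain ⟨a, ha⟩ := (Equiv.Perm.mem_cycleFactorsFinset_iff.1 hc).1.nonempty_support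
        refine ⟨a, ?_⟩
        have hfa : f a ≠ a := Equiv.Perm.mem_support.1
          (Equiv.Perm.mem_cycleFactorsFinset_support_le hc ha)
        simp only [F, dif_neg hfa, Sum.inl.injEq, Subtype.mk.injEq]
        exact (Equiv.Perm.cycle_is_cycleOf ha hc).symm
      · exact ⟨a, by simp [F, ha]⟩
    · intro a b
      rw [Set.pair_eq_singleton, ← Subgroup.zpowers_eq_closure]
      have h1 : (∃ g ∈ Subgroup.zpowers f, g b = a) ↔ f.SameCycle b a := by
        simp [Subgroup.mem_zpowers_iff, Equiv.Perm.SameCycle]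
      rw [h1]
      by_cases ha : f a = a
      · by_cases hb : f b = b
        · simp only [F, ha, hb, dif_pos, Sum.inr.injEq, Subtype.mk.injEq]
          constructor
          · rintro rfl
            exact Equiv.Perm.SameCycle.refl _ _
          · intro h
            exact (h.symm.eq_of_left ha)
        · simp only [F, ha, hb, dif_pos, dif_neg, not_false_eq_true, reduceCtorEq, false_iff]
          intro h
          have := h.symm.eq_of_left ha
          exact hb (this ▸ ha)
      · by_cases hb : f b = b
        · simp only [F, ha, hb, dif_pos, dif_neg, not_false_eq_true, reduceCtorEq, false_iff]
          intro h
          have := h.eq_of_left hb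
          exact ha (this ▸ hb)
        · simp only [F, ha, hb, dif_neg, not_false_eq_true, Sum.inl.injEq, Subtype.mk.injEq]
          rw [Equiv.Perm.sameCycle_iff_cycleOf_eq_of_mem_support (Equiv.Perm.mem_support.2 hb)
            (Equiv.Perm.mem_support.2 ha), eq_comm]
  have hfix : Fintype.card {a : α // f a = a} + f.support.card = Fintype.card α := by
    rw [Fintype.card_subtype, ← Finset.card_univ,
      ← Finset.card_filter_add_card_filter_not (s := Finset.univ) (fun a => f a = a)]
    rfl
  have hct : Multiset.card f.cycleType = f.cycleFactorsFinset.card := by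
    rw [Equiv.Perm.cycleType_def, Multiset.card_map]; rfl
  rw [Equiv.Perm.sign_of_cycleType, Equiv.Perm.sum_cycleType, hc, Nat.card_sum,
    Nat.card_eq_fintype_card, Nat.card_eq_fintype_card, Fintype.card_coe, hct, ← hfix]
  have : Fintype.card {a // f a = a} + f.support.card + (f.cycleFactorsFinset.card +
    Fintype.card {a // f a = a}) = (f.support.card + f.cycleFactorsFinset.card) +
      2 * Fintype.card {a // f a = a} := by ring
  rw [this, pow_add _ _ (2 * _), pow_mul]
  simp

end Cycles

section Signs

variable {α : Type*}

/-! ### Signs of permutations built from pair partitions -/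

theorem IsPairing.mul_self {p : Equiv.Perm α} (hp : IsPairing p) : p * p = 1 := Equiv.ext hp.1

/-- The permutation `q ∘ p` of the set `{x}`, extended by the identity. -/
def halfTurn (x : α → Bool) {p q : Equiv.Perm α} (hp : IsPairing p) (hq : IsPairing q)
    (xp : Alternates x p) (xq : Alternates x q) : Equiv.Perm α where
  toFun a := if x a then q (p a) else a
  invFun a := if x a then p (q a) else a
  left_inv a := by
    by_cases h : x a <;> simp [h, xp a, xq (p a), hp.1, hq.1]
  right_inv a := by
    by_cases h : x a <;> simp [h, xq a, xp (q a), hp.1, hq.1]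

theorem card_eq_two_mul_card_false {p : Equiv.Perm α} {x : α → Bool} [Fintype α]
    (xp : Alternates x p) :
    Fintype.card α = 2 * Fintype.card {a : α // x a = false} := by
  classical
  have h1 : Fintype.card {a : α // x a = true} = Fintype.card {a : α // x a = false} := by
    refine Fintype.card_congr (Equiv.subtypeEquiv p fun a => ?_)
    rw [xp a]; simp
  have h2 := Fintype.card_subtype_compl (fun a => x a = true)
  have h3 := Fintype.card_subtype_le (fun a => x a = true)
  simp only [Bool.not_eq_true] at h2
  omega

/-- On `{x}` the half turn walks around each cycle of `p ∪ q` two steps at a time, giving one orbit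
per cycle. It fixes every point outside `{x}`. -/
theorem cycleCount_halfTurn [Finite α] (x : α → Bool) {p q : Equiv.Perm α} (hp : IsPairing p)
    (hq : IsPairing q) (xp : Alternates x p) (xq : Alternates x q) :
    cycleCount (halfTurn x hp hq xp xq) (halfTurn x hp hq xp xq) =
      cycleCount p q + Nat.card {a : α // x a = false} := by
  have hinj : Function.Injective (fun k : ℕ => 2 ^ k) := Nat.pow_right_injective le_rfl
  apply hinj
  change 2 ^ _ = 2 ^ _
  have h2 : (2 : ℕ) ^ Nat.card {a : α // x a = false} =
      Nat.card ({a : α // x a = false} → Bool) := by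
    rw [Nat.card_fun]; simp
  rw [pow_add, h2, ← card_invariant, ← card_invariant, ← Nat.card_prod]
  have htrue : ∀ h : α → Bool, (∀ a, h (halfTurn x hp hq xp xq a) = h a) →
      ∀ a, x a = true → h (q (p a)) = h a := by
    intro h hh a ha
    have := hh a
    simpa [halfTurn, ha] using this
  refine Nat.card_congr
    { toFun := fun h => (⟨fun a => if x a then h.1 a else h.1 (p a), fun a => ?_, fun a => ?_⟩,
        fun a => h.1 a.1)
      invFun := fun k => ⟨fun a => if ha : x a = true then k.1.1 a
        else k.2 ⟨a, by simpa using ha⟩, fun a => ?_, fun a => ?_⟩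
      left_inv := fun h => ?_
      right_inv := fun k => ?_ }
  · by_cases ha : x a <;> simp [xp a, ha, hp.1]
  · by_cases ha : x a
    · have h1 := htrue h.1 h.2.1 (p (q a)) (by simp [xp (q a), xq a, ha])
      rw [hp.1, hq.1] at h1
      simp [xq a, ha, h1]
    · have h1 := htrue h.1 h.2.1 (p a) (by simp [xp a, ha])
      rw [hp.1] at h1
      simp [xq a, ha, h1]
  · by_cases ha : x a
    · simp [halfTurn, ha, xq (p a), xp a, k.1.2.1 a, k.1.2.2 (p a)]
    · simp [halfTurn, ha]
  · by_cases ha : x a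
    · simp [halfTurn, ha, xq (p a), xp a, k.1.2.1 a, k.1.2.2 (p a)]
    · simp [halfTurn, ha]
  · ext a
    by_cases ha : x a
    · simp [ha]
    · simp [ha]
  · ext a
    · by_cases ha : x a
      · simp [ha]
      · simp [ha, xp a, k.1.2.1 a]
    · simp [a.2]

theorem sign_halfTurn [Fintype α] [DecidableEq α] (x : α → Bool) {p q : Equiv.Perm α}
    (hp : IsPairing p) (hq : IsPairing q) (xp : Alternates x p) (xq : Alternates x q) :
    Equiv.Perm.sign (halfTurn x hp hq xp xq) =
      (-1) ^ (Fintype.card {a : α // x a = false} + cycleCount p q) := by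
  rw [sign_eq_neg_one_pow_cycleCount, cycleCount_halfTurn, card_eq_two_mul_card_false xp,
    pow_add, pow_mul, Nat.card_eq_fintype_card, add_comm]
  simp

/-- A pair partition is a product of a transversal and a two-point set. -/
def pairingEquiv (x : α → Bool) {p : Equiv.Perm α} (hp : IsPairing p) (xp : Alternates x p) :
    {a : α // x a = true} × Bool ≃ α where
  toFun u := if u.2 then u.1.1 else p u.1.1
  invFun a := if h : x a = true then (⟨a, h⟩, true) else (⟨p a, by simp [xp a, h]⟩, false)
  left_inv := by
    rintro ⟨⟨a, ha⟩, _ | _⟩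
    · simp [xp a, ha, hp.1]
    · simp [ha]
  right_inv a := by
    by_cases h : x a <;> simp [h, hp.1]

/-- The permutation that exchanges the elements of the pairs of `p` in the union `{y}` of pairs. -/
def flipPairs {p : Equiv.Perm α} (hp : IsPairing p) (y : α → Bool) (yp : ∀ a, y (p a) = y a) :
    Equiv.Perm α where
  toFun a := if y a then p a else a
  invFun a := if y a then p a else a
  left_inv a := by by_cases h : y a <;> simp [h, yp a, hp.1]
  right_inv a := by by_cases h : y a <;> simp [h, yp a, hp.1]

/-- The permutation is a product of disjoint transpositions, one for each pair in `{y}`; the set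
`{x}` is a transversal of the pairs. -/
theorem sign_flipPairs [Fintype α] [DecidableEq α] {p : Equiv.Perm α} (hp : IsPairing p)
    (y : α → Bool) (yp : ∀ a, y (p a) = y a) {x : α → Bool} (xp : Alternates x p) :
    Equiv.Perm.sign (flipPairs hp y yp) =
      ∏ a : {a : α // x a = true}, if y a.1 then (-1 : ℤˣ) else 1 := by
  have h1 : Equiv.Perm.sign (flipPairs hp y yp) = Equiv.Perm.sign (Equiv.prodCongrRight
      fun a : {a : α // x a = true} => if y a.1 then Equiv.swap true false else 1) := by
    symm
    refine Equiv.Perm.sign_eq_sign_of_equiv _ _ (pairingEquiv x hp xp) ?_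
    rintro ⟨⟨a, ha⟩, _ | _⟩
    · by_cases h : y a <;> simp [pairingEquiv, flipPairs, h, yp, hp.1]
    · by_cases h : y a <;> simp [pairingEquiv, flipPairs, h]
  rw [h1, Equiv.Perm.sign_prodCongrRight]
  refine Finset.prod_congr rfl fun a _ => ?_
  split_ifs
  · exact Equiv.Perm.sign_swap (by decide)
  · simp

/-- `R` acts in the same way on `{x}` and on its mirror image under `p`, so its sign is a square. -/
theorem sign_eq_one_of_commute [Fintype α] [DecidableEq α] {p : Equiv.Perm α} (hp : IsPairing p)
    {x : α → Bool} (xp : Alternates x p) (R : Equiv.Perm α) (hR : ∀ a, x (R a) = x a)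
    (hRp : ∀ a, R (p a) = p (R a)) : Equiv.Perm.sign R = 1 := by
  let R' : Equiv.Perm {a : α // x a = true} := R.subtypePerm fun a => by rw [hR]
  have h1 : Equiv.Perm.sign R = Equiv.Perm.sign (Equiv.prodCongrLeft fun _ : Bool => R') := by
    symm
    refine Equiv.Perm.sign_eq_sign_of_equiv _ _ (pairingEquiv x hp xp) ?_
    rintro ⟨⟨a, ha⟩, _ | _⟩
    · simp [pairingEquiv, R', hRp]
    · simp [pairingEquiv, R']
  rw [h1, Equiv.Perm.sign_prodCongrLeft]
  simp

theorem Alternates.xor_invariant {p : Equiv.Perm α} {x y : α → Bool} (hx : Alternates x p)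
    (hy : Alternates y p) (a : α) : xor (x (p a)) (y (p a)) = xor (x a) (y a) := by
  rw [hx a, hy a]; simp

/-- The permutation that exchanges the elements of the pairs of `p` that `x` and `y` orient
differently. -/
def reorient {p : Equiv.Perm α} (hp : IsPairing p) {x y : α → Bool} (xp : Alternates x p)
    (yp : Alternates y p) : Equiv.Perm α :=
  flipPairs hp (fun a => xor (x a) (y a)) (xp.xor_invariant yp)

theorem reorient_comm {p : Equiv.Perm α} (hp : IsPairing p) {u v : α → Bool}
    (up : Alternates u p) (vp : Alternates v p) (a : α) :
    reorient hp up vp (p a) = p (reorient hp up vp a) := by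
  by_cases h : (u a) = (v a) <;> simp [reorient, flipPairs, up a, vp a, h, hp.1]

theorem reorient_apply_right {p : Equiv.Perm α} (hp : IsPairing p) {u v : α → Bool}
    (up : Alternates u p) (vp : Alternates v p) (a : α) : v (reorient hp up vp a) = u a := by
  by_cases h : (u a) = (v a)
  · simp [reorient, flipPairs, h]
  · have h' : xor (u a) (v a) = true := by simpa using h
    simp only [reorient, flipPairs, Equiv.coe_fn_mk, h', if_true, vp a]
    revert h; cases u a <;> cases v a <;> simp

/-- The compatibility of orientations for three pair partitions. -/
theorem sign_reorient_mul [Fintype α] [DecidableEq α] {δ γ σ : Equiv.Perm α}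
    (hδ : IsPairing δ) (hγ : IsPairing γ) (hσ : IsPairing σ) {x y z : α → Bool}
    (xσ : Alternates x σ) (xδ : Alternates x δ) (yδ : Alternates y δ) (yγ : Alternates y γ)
    (zγ : Alternates z γ) (zσ : Alternates z σ) :
    Equiv.Perm.sign (reorient hδ xδ yδ) *
      Equiv.Perm.sign (reorient hγ yγ zγ) *
      Equiv.Perm.sign (reorient hσ zσ xσ) =
    (-1) ^ (cycleCount σ δ + cycleCount δ γ + cycleCount γ σ) *
      (-1) ^ (Fintype.card {a : α // x a = false}) := by
  set D := reorient hδ xδ yδ with hD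
  set G := reorient hγ yγ zγ with hG
  set S := reorient hσ zσ xσ with hS
  set K₀ := halfTurn x hσ hδ xσ xδ with hK₀
  set K₁ := halfTurn y hδ hγ yδ yγ with hK₁
  set K₂ := halfTurn z hγ hσ zγ zσ with hK₂
  have hyD : ∀ a, y (D a) = x a := reorient_apply_right hδ xδ yδ
  have hzG : ∀ a, z (G a) = y a := reorient_apply_right hγ yγ zγ
  have hxS : ∀ a, x (S a) = z a := reorient_apply_right hσ zσ xσ
  have hDδ : ∀ a, D (δ a) = δ (D a) := reorient_comm hδ xδ yδ
  have hGγ : ∀ a, G (γ a) = γ (G a) := reorient_comm hγ yγ zγ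
  have hSσ : ∀ a, S (σ a) = σ (S a) := reorient_comm hσ zσ xσ
  have half_true : ∀ {u : α → Bool} {p q : Equiv.Perm α} (hp : IsPairing p) (hq : IsPairing q)
      (up : Alternates u p) (uq : Alternates u q) (a : α), u a = true →
      halfTurn u hp hq up uq a = q (p a) := by
    intro u p q hp hq up uq a h
    simp [halfTurn, h]
  have half_false : ∀ {u : α → Bool} {p q : Equiv.Perm α} (hp : IsPairing p) (hq : IsPairing q)
      (up : Alternates u p) (uq : Alternates u q) (a : α), u a = false →
      halfTurn u hp hq up uq a = a := by
    intro u p q hp hq up uq a h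
    simp [halfTurn, h]
  -- Reorientations and half turns alternate around the triangle `δ`, `γ`, `σ`. The reorientations
  -- carry `x` to `y`, to `z` and back to `x`, while the half turns preserve these functions.
  let R : Equiv.Perm α := K₀ * S * K₂ * G * K₁ * D
  -- On `{x}` each reorientation commutes with its own pairing, so the two copies of `γ` and of `σ`
  -- cancel. What is left is the conjugate by `δ` of the action on the complement, so `R` commutes
  -- with `δ` and is even.
  have hRtrue : ∀ a, x a = true → R a = δ (S (G (D (δ a)))) := by
    intro a ha
    have h1 : y (D a) = true := by rw [hyD, ha]
    have h2 : z (G (D a)) = true := by rw [hzG, h1]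
    have h3 : x (S (G (D a))) = true := by rw [hxS, h2]
    simp only [R, Equiv.Perm.mul_apply]
    rw [hK₁, half_true _ _ _ _ _ h1, hGγ]
    have h2' : z (γ (G (δ (D a)))) = true := by
      rw [zγ, hzG, yδ, h1]; rfl
    rw [hK₂, half_true _ _ _ _ _ h2', hγ.1, hSσ]
    have h3' : x (σ (S (G (δ (D a))))) = true := by
      rw [xσ, hxS, hzG, yδ, h1]; rfl
    rw [hK₀, half_true _ _ _ _ _ h3', hσ.1, hDδ]
  have hRfalse : ∀ a, x a = false → R a = S (G (D a)) := by
    intro a ha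
    have h1 : y (D a) = false := by rw [hyD, ha]
    have h2 : z (G (D a)) = false := by rw [hzG, h1]
    have h3 : x (S (G (D a))) = false := by rw [hxS, h2]
    simp only [R, Equiv.Perm.mul_apply]
    rw [hK₁, half_false _ _ _ _ _ h1, hK₂, half_false _ _ _ _ _ h2, hK₀,
      half_false _ _ _ _ _ h3]
  have hxSGD : ∀ a, x (S (G (D a))) = x a := by
    intro a
    rw [hxS, hzG, hyD]
  have hR : Equiv.Perm.sign R = 1 := by
    refine sign_eq_one_of_commute hδ xδ R (fun a => ?_) fun a => ?_
    · rcases h : x a with _ | _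
      · rw [hRfalse a h, hxSGD, h]
      · rw [hRtrue a h, xδ, hxSGD, xδ, h]; rfl
    · rcases h : x a with _ | _
      · rw [hRtrue (δ a) (by rw [xδ, h]; rfl), hRfalse a h, hδ.1]
      · rw [hRfalse (δ a) (by rw [xδ, h]; rfl), hRtrue a h, hδ.1]
  have hcy : Fintype.card {a : α // y a = false} = Fintype.card {a : α // x a = false} := by
    have h1 := card_eq_two_mul_card_false yδ
    have h2 := card_eq_two_mul_card_false xδ
    omega
  have hcz : Fintype.card {a : α // z a = false} = Fintype.card {a : α // x a = false} := by
    have h1 := card_eq_two_mul_card_false zσ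
    have h2 := card_eq_two_mul_card_false xδ
    omega
  have hprod : Equiv.Perm.sign D * Equiv.Perm.sign G * Equiv.Perm.sign S =
      Equiv.Perm.sign K₀ * Equiv.Perm.sign K₁ * Equiv.Perm.sign K₂ := by
    have h1 : (Equiv.Perm.sign D * Equiv.Perm.sign G * Equiv.Perm.sign S) *
        (Equiv.Perm.sign K₀ * Equiv.Perm.sign K₁ * Equiv.Perm.sign K₂) = 1 := by
      rw [← hR]
      simp only [R, Equiv.Perm.sign_mul]
      ac_rfl
    rw [mul_eq_one_iff_eq_inv] at h1
    rw [h1, Int.units_inv_eq_self]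
  rw [hprod, hK₀, hK₁, hK₂, sign_halfTurn, sign_halfTurn, sign_halfTurn, hcy, hcz]
  simp only [pow_add]
  have : ((-1 : ℤˣ) ^ Fintype.card {a : α // x a = false}) *
      ((-1 : ℤˣ) ^ Fintype.card {a : α // x a = false}) = 1 := by
    rw [← sq, Int.units_sq]
  generalize ((-1 : ℤˣ) ^ Fintype.card {a : α // x a = false}) = e at this ⊢
  calc _ = (e * e) * ((-1) ^ cycleCount σ δ * (-1) ^ cycleCount δ γ * (-1) ^ cycleCount γ σ * e) := by
        ac_rfl
    _ = _ := by rw [this, one_mul]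

end Signs

section Wick

/-! ### Moments of Gaussian variables and pair partitions -/

open scoped Nat in
-- The even integrand reduces to a half-line integral, which is a value of the Gamma function at `k
-- + 1 / 2`. For `k = 0` truncated subtraction gives `0‼ = 1`, as it should.
theorem integral_pow_two_mul_gaussianReal (k : ℕ) :
    ∫ x, x ^ (2 * k) ∂gaussianReal 0 1 = (2 * k - 1 : ℕ)‼ := by
  rw [integral_gaussianReal_eq_integral_smul one_ne_zero]
  have h1 : ∀ x : ℝ, gaussianPDFReal 0 1 x • x ^ (2 * k) =
      (√(2 * Real.pi))⁻¹ * (fun y : ℝ => y ^ ((2 * k : ℕ) : ℝ) *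
        Real.exp (-(1 / 2) * y ^ (2 : ℝ))) |x| := by
    intro x
    simp only [gaussianPDFReal_def, smul_eq_mul, NNReal.coe_one, mul_one, sub_zero]
    rw [Real.rpow_natCast, pow_mul |x|, sq_abs, Real.rpow_ofNat, sq_abs, ← pow_mul, mul_assoc,
      mul_comm (x ^ (2 * k))]
    congr 3
    ring
  simp_rw [h1]
  rw [integral_const_mul, integral_comp_abs (f := fun y : ℝ => y ^ ((2 * k : ℕ) : ℝ) *
        Real.exp (-(1 / 2) * y ^ (2 : ℝ))),
    integral_rpow_mul_exp_neg_mul_rpow (by norm_num) (by push_cast; linarith [k.cast_nonneg (α := ℝ)])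
      (by norm_num)]
  have h2 : ((2 * k : ℕ) + 1 : ℝ) / 2 = k + 1 / 2 := by push_cast; ring
  have h3 : (1 / 2 : ℝ) ^ (-((2 * k : ℕ) + 1 : ℝ) / 2) = 2 ^ k * √2 := by
    rw [neg_div, h2, one_div, Real.inv_rpow (by norm_num), Real.rpow_neg (by norm_num), inv_inv,
      Real.rpow_add (by norm_num), Real.rpow_natCast, Real.sqrt_eq_rpow, one_div]
  rw [h3, h2, Real.Gamma_nat_add_half, Real.sqrt_mul (by norm_num)]
  have h4 : √2 ≠ 0 := by positivity
  have h5 : √Real.pi ≠ 0 := by have := Real.pi_pos; positivity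
  field_simp

theorem integral_pow_odd_gaussianReal {m : ℕ} (hm : Odd m) :
    ∫ x, x ^ m ∂gaussianReal 0 1 = 0 := by
  have h1 : ∫ x, x ^ m ∂gaussianReal 0 1 = ∫ x, (-x) ^ m ∂gaussianReal 0 1 := by
    conv_lhs => rw [← neg_zero, ← gaussianReal_map_neg]
    rw [integral_map (by fun_prop) (by fun_prop)]
  have h2 : ∀ x : ℝ, (-x) ^ m = -x ^ m := hm.neg_pow
  simp_rw [h2, integral_neg] at h1
  linarith

theorem isPairing_iff_cycleType {α : Type*} [Fintype α] [DecidableEq α] {k : ℕ}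
    (hk : Fintype.card α = 2 * k) (p : Equiv.Perm α) :
    IsPairing p ↔ p.cycleType = Multiset.replicate k 2 := by
  constructor
  · intro hp
    have h1 := Equiv.Perm.cycleType_of_pow_prime_eq_one (σ := p) (p := 2)
      (by rw [sq, hp.mul_self])
    have h2 := p.sum_cycleType
    have h3 : p.support = Finset.univ := by
      ext a; simpa using hp.2 a
    rw [h1, h3, Finset.card_univ, hk, Multiset.sum_replicate, smul_eq_mul] at h2
    rw [h1]
    congr 1
    omega
  · intro h
    refine ⟨fun a => ?_, fun a => ?_⟩
    · have h1 : p ^ 2 = 1 := by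
        rw [← orderOf_dvd_iff_pow_eq_one, ← Equiv.Perm.lcm_cycleType, h, Multiset.lcm_dvd]
        intro b hb
        rw [Multiset.eq_of_mem_replicate hb]
      rw [← Equiv.Perm.mul_apply, ← sq, h1]; rfl
    · have h2 := p.sum_cycleType
      rw [h, Multiset.sum_replicate, smul_eq_mul, mul_comm, ← hk, eq_comm,
        Finset.card_eq_iff_eq_univ] at h2
      exact Equiv.Perm.mem_support.1 (h2 ▸ Finset.mem_univ a)

open scoped Nat in
-- Pairings of `2 * k` points form one conjugacy class, of cycle type `2 ^ k`, whose centralizers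
-- have order `2 ^ k * k!`, that is `(2 * k)‼`.
theorem card_isPairing {α : Type*} [Fintype α] [DecidableEq α] {k : ℕ}
    (hk : Fintype.card α = 2 * k) :
    Nat.card {p : Equiv.Perm α // IsPairing p} = (2 * k - 1)‼ := by
  have h1 := Equiv.Perm.card_of_cycleType_mul_eq α (Multiset.replicate k 2)
  have h2 : Nat.card {p : Equiv.Perm α // IsPairing p} =
      (Finset.univ.filter fun g : Equiv.Perm α => g.cycleType = Multiset.replicate k 2).card := by
    simp_rw [isPairing_iff_cycleType hk]
    rw [Nat.card_eq_fintype_card, Fintype.card_subtype]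
  have h3 : ∏ n ∈ (Multiset.replicate k 2).toFinset, ((Multiset.replicate k 2).count n)! = k ! := by
    rcases Nat.eq_zero_or_pos k with rfl | hk0
    · simp
    · rw [Multiset.toFinset_replicate, if_neg hk0.ne']
      simp
  rw [← h2, h3, Multiset.sum_replicate, Multiset.prod_replicate, hk, smul_eq_mul, mul_comm k 2,
    if_pos ⟨le_rfl, fun a ha => (Multiset.eq_of_mem_replicate ha).ge⟩, Nat.sub_self,
    Nat.factorial_zero, one_mul, ← Nat.doubleFactorial_two_mul] at h1
  have h4 : (2 * k)! = (2 * k - 1)‼ * (2 * k)‼ := by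
    cases k with
    | zero => simp
    | succ k =>
      rw [show 2 * (k + 1) = (2 * k + 1) + 1 by ring, Nat.factorial_eq_mul_doubleFactorial,
        Nat.add_sub_cancel, mul_comm]
  rw [h4] at h1
  exact Nat.eq_of_mul_eq_mul_right (Nat.doubleFactorial_pos _) h1

/-- In even cardinality both sides are the same double factorial. In odd cardinality the moment
vanishes by symmetry, and an alternating function would split the set into two equal halves, so no
pairing exists. -/
theorem integral_pow_card_gaussianReal (α : Type*) [Fintype α] :
    ∫ x, x ^ Fintype.card α ∂gaussianReal 0 1 = Nat.card {p : Equiv.Perm α // IsPairing p} := by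
  classical
  rcases Nat.even_or_odd' (Fintype.card α) with ⟨k, hk | hk⟩
  · rw [card_isPairing hk, hk, integral_pow_two_mul_gaussianReal]
  · rw [integral_pow_odd_gaussianReal ⟨k, hk⟩]
    have : IsEmpty {p : Equiv.Perm α // IsPairing p} := by
      refine ⟨fun p => ?_⟩
      obtain ⟨x, hx, -⟩ := exists_alternates p.2 p.2
      have := card_eq_two_mul_card_false hx
      omega
    simp

/-- A pair partition that pairs elements with equal values of `s` consists of pair partitions of
the fibers of `s`. -/
def pairingFiberEquiv {α ι : Type*} (s : α → ι) :
    {p : Equiv.Perm α // IsPairing p ∧ ∀ a, s (p a) = s a} ≃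
      ∀ j, {p : Equiv.Perm {a // s a = j} // IsPairing p} where
  toFun p j := ⟨p.1.subtypePerm fun a => by rw [p.2.2], fun a => Subtype.ext (p.2.1.1 a),
    fun a h => p.2.1.2 a (congrArg Subtype.val h)⟩
  invFun g := ⟨DomMulAct.stabilizerEquiv_invFun_aux fun j => (g j).1, ⟨fun a => by
      change DomMulAct.stabilizerEquiv_invFun (f := s) (fun j => (g j).1)
        (DomMulAct.stabilizerEquiv_invFun (f := s) (fun j => (g j).1) a) = a
      rw [DomMulAct.stabilizerEquiv_invFun_eq _ (DomMulAct.comp_stabilizerEquiv_invFun _ a)]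
      exact congrArg Subtype.val ((g (s a)).2.1 ⟨a, rfl⟩), fun a h =>
      (g (s a)).2.2 ⟨a, rfl⟩ (Subtype.ext h)⟩,
    fun a => DomMulAct.comp_stabilizerEquiv_invFun (f := s) (fun j => (g j).1) a⟩
  left_inv p := rfl
  right_inv g := by
    funext j
    apply Subtype.ext
    ext a
    exact DomMulAct.stabilizerEquiv_invFun_eq (fun j => (g j).1) a.2

/-- Wick's formula for products of independent standard Gaussian variables. -/
theorem prod_integral_pow_eq_card_pairings {α ι : Type*} [Fintype α] [Fintype ι] [DecidableEq ι]
    (s : α → ι) :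
    ∏ j, ∫ x, x ^ Fintype.card {a // s a = j} ∂gaussianReal 0 1 =
      Nat.card {p : Equiv.Perm α // IsPairing p ∧ ∀ a, s (p a) = s a} := by
  rw [Nat.card_congr (pairingFiberEquiv s), Nat.card_pi, Nat.cast_prod]
  exact Finset.prod_congr rfl fun j _ => integral_pow_card_gaussianReal _

/-! ### Moments of the coordinates of quaternion Gaussian variables -/

variable {Ω : Type*} [MeasurableSpace Ω] {μ : Measure Ω}

/-- The coordinates of a quaternion. -/
def quaternionCoord (q : ℍ[ℝ]) (e : Fin 4) : ℝ := ![q.re, q.imI, q.imJ, q.imK] e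

theorem measurable_quaternionCoord (e : Fin 4) : Measurable fun q => quaternionCoord q e := by
  fin_cases e
  · exact Quaternion.continuous_re.measurable
  · exact Quaternion.continuous_imI.measurable
  · exact Quaternion.continuous_imJ.measurable
  · exact Quaternion.continuous_imK.measurable

theorem IsQuaternionGaussian.aemeasurable {Z : Ω → ℍ[ℝ]} (hZ : IsQuaternionGaussian Z μ) :
    AEMeasurable Z μ := by
  obtain ⟨ξ, hξ, -, h⟩ := hZ
  have h1 : Z = fun ω => (Quaternion.linearIsometryEquivTuple.symm
      (WithLp.toLp 2 fun i => ξ i ω)) := by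
    funext ω
    rw [h ω]
    ext <;> simp
  rw [h1]
  refine Quaternion.linearIsometryEquivTuple.symm.continuous.measurable.comp_aemeasurable ?_
  refine (WithLp.measurable_toLp 2 _).comp_aemeasurable ?_
  exact aemeasurable_pi_lambda _ fun i => (hξ i).aemeasurable

theorem IsQuaternionGaussian.hasLaw {Z : Ω → ℍ[ℝ]} (hZ : IsQuaternionGaussian Z μ) (e : Fin 4) :
    HasLaw (fun ω => quaternionCoord (Z ω) e) (gaussianReal 0 1) μ := by
  obtain ⟨ξ, hξ, -, h⟩ := hZ
  have : (fun ω => quaternionCoord (Z ω) e) = ξ e := by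
    funext ω
    rw [h ω]
    fin_cases e <;> rfl
  rw [this]
  exact hξ e

theorem IsQuaternionGaussian.memLp [IsProbabilityMeasure μ] {Z : Ω → ℍ[ℝ]}
    (hZ : IsQuaternionGaussian Z μ) (e : Fin 4) (p : NNReal) :
    MemLp (fun ω => quaternionCoord (Z ω) e) p μ := by
  have h1 := hZ.hasLaw e
  have h2 := memLp_id_gaussianReal (μ := 0) (v := 1) p
  rw [← h1.map_eq, memLp_map_measure_iff (by fun_prop) h1.aemeasurable] at h2
  exact h2

theorem IsQuaternionGaussian.integral_prod_pow {Z : Ω → ℍ[ℝ]} (hZ : IsQuaternionGaussian Z μ)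
    (m : Fin 4 → ℕ) : ∫ ω, ∏ e, quaternionCoord (Z ω) e ^ m e ∂μ =
      ∏ e, ∫ x, x ^ m e ∂gaussianReal 0 1 := by
  obtain ⟨ξ, hξ, hind, h⟩ := hZ
  have h1 : ∀ ω e, quaternionCoord (Z ω) e = ξ e ω := by
    intro ω e
    rw [h ω]
    fin_cases e <;> rfl
  simp_rw [h1]
  rw [hind.integral_fun_prod_comp (f := fun e x => x ^ m e) (fun e => (hξ e).aemeasurable)
    fun e => by fun_prop]
  refine Finset.prod_congr rfl fun e _ => ?_
  rw [← (hξ e).map_eq, integral_map (hξ e).aemeasurable (by fun_prop)]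

/-- Grouping equal factors gives a product of powers of the variables labelled by `ι × Fin 4`. The
expectation factors first by independence of the `Z i`, then by independence of the coordinates of
each. -/
theorem integral_prod_quaternionCoord {α ι : Type*} [Fintype α] [Fintype ι] [DecidableEq ι]
    {Z : ι → Ω → ℍ[ℝ]} (hZ : ∀ i, IsQuaternionGaussian (Z i) μ) (hind : iIndepFun Z μ)
    (s : α → ι × Fin 4) :
    ∫ ω, ∏ a, quaternionCoord (Z (s a).1 ω) (s a).2 ∂μ =
      Nat.card {p : Equiv.Perm α // IsPairing p ∧ ∀ a, s (p a) = s a} := by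
  have h1 : ∀ ω, ∏ a, quaternionCoord (Z (s a).1 ω) (s a).2 =
      ∏ i, ∏ e, quaternionCoord (Z i ω) e ^ Fintype.card {a // s a = (i, e)} := by
    intro ω
    rw [← Finset.prod_fiberwise' Finset.univ s fun j => quaternionCoord (Z j.1 ω) j.2,
      Fintype.prod_prod_type]
    simp only [Finset.prod_const, Fintype.card_subtype]
  simp_rw [h1]
  rw [hind.integral_fun_prod_comp
    (f := fun i q => ∏ e, quaternionCoord q e ^ Fintype.card {a // s a = (i, e)})
    (fun i => (hZ i).aemeasurable) fun i => ?_]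
  · rw [← prod_integral_pow_eq_card_pairings, Fintype.prod_prod_type]
    exact Finset.prod_congr rfl fun i _ => (hZ i).integral_prod_pow _
  · refine Measurable.aestronglyMeasurable ?_
    exact Finset.measurable_fun_prod _ fun e _ => (measurable_quaternionCoord e).pow_const _

/-- Hölder's inequality: each of the `Fintype.card α` factors lies in `L^p` with `p = Fintype.card
α`. -/
theorem integrable_prod_quaternionCoord [IsProbabilityMeasure μ] {α ι : Type*} [Fintype α]
    {Z : ι → Ω → ℍ[ℝ]} (hZ : ∀ i, IsQuaternionGaussian (Z i) μ) (s : α → ι × Fin 4) :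
    Integrable (fun ω => ∏ a, quaternionCoord (Z (s a).1 ω) (s a).2) μ := by
  rcases isEmpty_or_nonempty α with hα | hα
  · simp
  have h1 := MemLp.prod' (s := Finset.univ) (μ := μ)
    (f := fun a ω => quaternionCoord (Z (s a).1 ω) (s a).2)
    (p := fun _ => ((Fintype.card α : NNReal) : ENNReal))
    fun a _ => (hZ (s a).1).memLp (s a).2 (Fintype.card α)
  rw [← memLp_one_iff_integrable]
  convert h1
  simp only [Finset.sum_const, Finset.card_univ, nsmul_eq_mul, ENNReal.coe_natCast]
  rw [ENNReal.mul_inv_cancel (by simp) (by simp), inv_one]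

end Wick

section Representation

/-! ### The two-dimensional complex representation of the quaternions -/

open scoped ComplexConjugate

/-- The two-dimensional complex representation of the quaternions. -/
noncomputable def quaternionMatrix : ℍ[ℝ] →+* Matrix Bool Bool ℂ where
  toFun x := Matrix.of fun u v => match u, v with
    | true, true => ⟨x.re, x.imI⟩
    | true, false => ⟨x.imJ, x.imK⟩
    | false, true => ⟨-x.imJ, x.imK⟩
    | false, false => ⟨x.re, -x.imI⟩
  map_one' := by
    ext (_ | _) (_ | _) <;> simp [Complex.ext_iff]
  map_zero' := by
    ext (_ | _) (_ | _) <;> simp [Complex.ext_iff]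
  map_add' x y := by
    ext (_ | _) (_ | _) <;> simp [Complex.ext_iff] <;> ring
  map_mul' x y := by
    ext (_ | _) (_ | _) <;> simp [Complex.ext_iff, Matrix.mul_apply] <;>
      constructor <;> ring

theorem trace_quaternionMatrix (x : ℍ[ℝ]) : (quaternionMatrix x).trace = 2 * (x.re : ℂ) := by
  simp [Matrix.trace, quaternionMatrix, Complex.ext_iff]
  ring

/-- The conjugate quaternion has the adjugate matrix. The flip of both indices is what makes the
index functions alternate instead of being constant on pairs. -/
theorem quaternionMatrix_star (x : ℍ[ℝ]) (u v : Bool) :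
    quaternionMatrix (star x) u v = (if u = v then 1 else -1) * quaternionMatrix x (!v) (!u) := by
  rcases u with _ | _ <;> rcases v with _ | _ <;> simp [quaternionMatrix, Complex.ext_iff]

/-- The matrices of the quaternion units. -/
noncomputable def unitMatrix (e : Fin 4) : Matrix Bool Bool ℂ :=
  quaternionMatrix ⟨(Pi.single e 1 : Fin 4 → ℝ) 0, (Pi.single e 1 : Fin 4 → ℝ) 1,
    (Pi.single e 1 : Fin 4 → ℝ) 2, (Pi.single e 1 : Fin 4 → ℝ) 3⟩

theorem quaternionMatrix_eq_sum (x : ℍ[ℝ]) (u v : Bool) :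
    quaternionMatrix x u v = ∑ e, (quaternionCoord x e : ℂ) * unitMatrix e u v := by
  rcases u with _ | _ <;> rcases v with _ | _ <;>
    simp [quaternionMatrix, unitMatrix, Complex.ext_iff, quaternionCoord, Fin.sum_univ_four]

/-- Completeness relation: the sum of `U ⊗ U` over the four units is `2 ε ⊗ ε`, where `ε` is the
antisymmetric form on `ℂ²`. -/
theorem sum_unitMatrix_mul_unitMatrix (u v u' v' : Bool) :
    ∑ e, unitMatrix e u v * unitMatrix e u' v' =
      if u' = (!u) ∧ v' = (!v) then (if xor u v then -1 else 1) * 2 else 0 := by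
  rcases u with _ | _ <;> rcases v with _ | _ <;> rcases u' with _ | _ <;> rcases v' with _ | _ <;>
    simp [quaternionMatrix, unitMatrix, Complex.ext_iff, Fin.sum_univ_four] <;> norm_num

/-! ### Traces of products along cycles -/

theorem prod_ofFn_apply {ι R : Type*} [Fintype ι] [DecidableEq ι] [CommSemiring R] {d : ℕ}
    (M : Fin (d + 1) → Matrix ι ι R) (u v : ι) :
    (List.ofFn M).prod u v = ∑ s : Fin d → ι, ∏ r, M r ((Fin.cons u s : Fin (d + 1) → ι) r)
      ((Fin.snoc s v : Fin (d + 1) → ι) r) := by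
  induction d generalizing u with
  | zero => simp [Fin.snoc]
  | succ d ih =>
    rw [List.ofFn_succ, List.prod_cons, Matrix.mul_apply,
      ← (Fin.consEquiv fun _ => ι).sum_comp, Fintype.sum_prod_type]
    refine Finset.sum_congr rfl fun w _ => ?_
    rw [ih, Finset.mul_sum]
    refine Finset.sum_congr rfl fun s _ => ?_
    simp only [Fin.consEquiv, Equiv.coe_fn_mk]
    rw [Fin.prod_univ_succ (n := d + 1), ← Fin.cons_snoc_eq_snoc_cons]
    simp

/-- The trace closes the path of matrix indices into a loop, so the row index of each factor is the
column index of its cyclic predecessor. For `d = 0` this would fail, since the trace of the identity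
is the cardinality of `ι`. -/
theorem trace_prod_ofFn {ι R : Type*} [Fintype ι] [DecidableEq ι] [CommSemiring R] {d : ℕ}
    (hd : 0 < d) (M : Fin d → Matrix ι ι R) :
    (List.ofFn M).prod.trace =
      ∑ s : Fin d → ι, ∏ r, M r (s ((finRotate d).symm r)) (s r) := by
  obtain ⟨d, rfl⟩ : ∃ d', d = d' + 1 := ⟨d - 1, by omega⟩
  rw [← (Fin.snocEquiv fun _ => ι).sum_comp, Fintype.sum_prod_type, Matrix.trace]
  refine Finset.sum_congr rfl fun u _ => ?_
  rw [Matrix.diag_apply, prod_ofFn_apply]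
  refine Finset.sum_congr rfl fun s _ => Finset.prod_congr rfl fun r _ => ?_
  simp only [Fin.snocEquiv, Equiv.coe_fn_mk]
  congr 1
  refine Fin.cases ?_ (fun r => ?_) r
  · have : (finRotate (d + 1)).symm 0 = Fin.last d := by
      rw [Equiv.symm_apply_eq, finRotate_last]
    rw [this]
    simp
  · have : (finRotate (d + 1)).symm r.succ = r.castSucc := by
      rw [Equiv.symm_apply_eq, finRotate_apply, Fin.coeSucc_eq_succ]
    rw [this]
    simp

theorem prod_trace_prod_ofFn {ι R : Type*} [Fintype ι] [DecidableEq ι] [CommSemiring R] {n : ℕ}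
    (c : Composition n) (N : Fin n → Matrix ι ι R) :
    ∏ k : Fin c.length, (List.ofFn fun r : Fin (c.blocksFun k) => N (c.embedding k r)).prod.trace =
      ∑ s : Fin n → ι, ∏ i, N i (s ((nextInBlock c).symm i)) (s i) := by
  have h1 : ∀ k : Fin c.length,
      (List.ofFn fun r : Fin (c.blocksFun k) => N (c.embedding k r)).prod.trace =
      ∑ s : Fin (c.blocksFun k) → ι, ∏ r, N (c.embedding k r) (s ((finRotate _).symm r)) (s r) :=
    fun k => trace_prod_ofFn (c.one_le_blocksFun k) _
  simp_rw [h1]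
  rw [Finset.prod_univ_sum, Fintype.piFinset_univ]
  let E : (Fin n → ι) ≃ (∀ k : Fin c.length, Fin (c.blocksFun k) → ι) :=
    (Equiv.arrowCongr c.blocksFinEquiv.symm (Equiv.refl ι)).trans
      (Equiv.piCurry fun _ _ => ι)
  rw [← E.sum_comp]
  refine Finset.sum_congr rfl fun s _ => ?_
  rw [← c.blocksFinEquiv.prod_comp, Fintype.prod_sigma]
  refine Finset.prod_congr rfl fun k _ => Finset.prod_congr rfl fun r _ => ?_
  have h2 : (nextInBlock c).symm (c.blocksFinEquiv ⟨k, r⟩) =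
      c.blocksFinEquiv ⟨k, (finRotate _).symm r⟩ := by
    rw [Equiv.symm_apply_eq]
    simp only [nextInBlock, Equiv.permCongr_apply, Equiv.symm_apply_apply,
      Equiv.sigmaCongrRight_apply, Equiv.apply_symm_apply]
  rw [h2]
  rfl

/-- The extension of a function of the positive indices to an alternating function for `δ`. -/
def deltaExtendEquiv (n : ℕ) :
    (Fin n → Bool) ≃ {y : SignedIndex n → Bool // Alternates y (deltaPairing n)} where
  toFun p := ⟨fun a => if a.2 then p a.1 else !p a.1, by
    rintro ⟨i, _ | _⟩ <;> simp [deltaPairing]⟩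
  invFun y i := y.1 (i, true)
  left_inv p := by ext; simp
  right_inv y := by
    ext ⟨i, _ | _⟩
    · simp only [Bool.false_eq_true, if_false]
      exact (y.2 (i, true)).symm
    · simp

/-- The extension of a function of the positive indices to an alternating function for `σ`. -/
def sigmaExtendEquiv {n : ℕ} (c : Composition n) :
    (Fin n → Bool) ≃ {z : SignedIndex n → Bool // Alternates z (sigmaPairing c)} where
  toFun q := ⟨fun a => if a.2 then q a.1 else !q ((nextInBlock c).symm a.1), by
    rintro ⟨i, _ | _⟩ <;> simp [sigmaPairing]⟩
  invFun z i := z.1 (i, true)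
  left_inv p := by ext; simp
  right_inv z := by
    ext ⟨i, _ | _⟩
    · simp only [Bool.false_eq_true, if_false]
      have := z.2 (i, false)
      simp only [sigmaPairing, Equiv.coe_fn_mk] at this
      simp [this]
    · simp

theorem prod_signedIndex {n : ℕ} {M : Type*} [CommMonoid M] (f : SignedIndex n → M) :
    ∏ a, f a = ∏ i, f (i, true) * f (i, false) := by
  rw [Fintype.prod_prod_type]
  simp

instance {n : ℕ} (p : Equiv.Perm (SignedIndex n)) (y : SignedIndex n → Bool) :
    Decidable (Alternates y p) := by
  unfold Alternates; infer_instance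

/-- The index summed inside `star X * X` is shared by the lines `-i` and `i` and becomes `y`; the
index between consecutive factors of a block is shared by the pairs of `σ` and becomes `z`. The sign
is that of `quaternionMatrix_star`, and each trace brings a factor `1 / 2`. -/
theorem prod_re_eq_sum_alternates {n : ℕ} (c : Composition n) (x : SignedIndex n → ℍ[ℝ]) :
    ((∏ k : Fin c.length, ((List.ofFn fun r : Fin (c.blocksFun k) =>
        star (x (c.embedding k r, false)) * x (c.embedding k r, true)).prod).re : ℝ) : ℂ) =
      (1 / 2) ^ c.length * ∑ y : {y : SignedIndex n → Bool // Alternates y (deltaPairing n)},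
        ∑ z : {z : SignedIndex n → Bool // Alternates z (sigmaPairing c)},
          (∏ i, if xor (y.1 (i, false)) (z.1 (i, false)) then (-1 : ℂ) else 1) *
            ∏ a, quaternionMatrix (x a) (y.1 a) (z.1 a) := by
  let N : Fin n → Matrix Bool Bool ℂ := fun i =>
    quaternionMatrix (star (x (i, false)) * x (i, true))
  have h1 : ∀ k : Fin c.length, (((List.ofFn fun r : Fin (c.blocksFun k) =>
        star (x (c.embedding k r, false)) * x (c.embedding k r, true)).prod.re : ℝ) : ℂ) =
      (1 / 2) * (List.ofFn fun r : Fin (c.blocksFun k) => N (c.embedding k r)).prod.trace := by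
    intro k
    have h2 : (List.ofFn fun r : Fin (c.blocksFun k) => N (c.embedding k r)) =
        (List.ofFn fun r : Fin (c.blocksFun k) =>
        star (x (c.embedding k r, false)) * x (c.embedding k r, true)).map quaternionMatrix := by
      rw [List.map_ofFn]; rfl
    rw [h2, ← map_list_prod, trace_quaternionMatrix]
    ring
  rw [Complex.ofReal_prod]
  simp_rw [h1]
  rw [Finset.prod_mul_distrib, prod_trace_prod_ofFn, Finset.prod_const, Finset.card_univ,
    Fintype.card_fin, Finset.sum_comm, ← (sigmaExtendEquiv c).sum_comp]
  congr 1
  refine Finset.sum_congr rfl fun q _ => ?_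
  simp only [N, map_mul, Matrix.mul_apply]
  rw [Finset.prod_univ_sum, Fintype.piFinset_univ, ← (deltaExtendEquiv n).sum_comp]
  refine Finset.sum_congr rfl fun p _ => ?_
  rw [prod_signedIndex, ← Finset.prod_mul_distrib]
  refine Finset.prod_congr rfl fun i _ => ?_
  rw [quaternionMatrix_star]
  simp only [deltaExtendEquiv, sigmaExtendEquiv, Equiv.coe_fn_mk, if_true, Bool.false_eq_true,
    if_false]
  rcases q ((nextInBlock c).symm i) with _ | _ <;> rcases p i with _ | _ <;> simp [mul_comm]

/-- A `φ` constant on pairs is a free choice of one unit per pair, so the sum factors over pairs and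
the completeness relation applies to each. A pair on which `y` and `z` differ contributes `-1`, the
sign of one transposition in `reorient`. -/
theorem sum_prod_unitMatrix {α : Type*} [Fintype α] [DecidableEq α] {p : Equiv.Perm α}
    (hp : IsPairing p) (y z : α → Bool) [Decidable (Alternates y p ∧ Alternates z p)] :
    ∑ φ : {φ : α → Fin 4 // ∀ a, φ (p a) = φ a}, ∏ a, unitMatrix (φ.1 a) (y a) (z a) =
      if h : Alternates y p ∧ Alternates z p then
        2 ^ (Fintype.card α / 2) * ((Equiv.Perm.sign (reorient hp h.1 h.2) : ℤ) : ℂ) else 0 := by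
  obtain ⟨x, xp, -⟩ := exists_alternates hp hp
  let E : {φ : α → Fin 4 // ∀ a, φ (p a) = φ a} ≃ ({a : α // x a = true} → Fin 4) :=
    { toFun := fun φ a => φ.1 a.1
      invFun := fun ψ => ⟨fun a => if h : x a = true then ψ ⟨a, h⟩
        else ψ ⟨p a, by simp [xp a, h]⟩, fun a => by
          by_cases h : x a <;> simp [xp a, h, hp.1]⟩
      left_inv := fun φ => by
        ext a
        by_cases h : x a <;> simp [h, φ.2 a]
      right_inv := fun ψ => by
        ext a
        simp [a.2] }
  have h1 : ∀ φ : {φ : α → Fin 4 // ∀ a, φ (p a) = φ a},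
      ∏ a, unitMatrix (φ.1 a) (y a) (z a) = ∏ b : {a : α // x a = true},
        unitMatrix (E φ b) (y b.1) (z b.1) * unitMatrix (E φ b) (y (p b.1)) (z (p b.1)) := by
    intro φ
    rw [← (pairingEquiv x hp xp).prod_comp, Fintype.prod_prod_type]
    refine Finset.prod_congr rfl fun b _ => ?_
    simp [pairingEquiv, E, φ.2]
  simp_rw [h1]
  rw [E.sum_comp fun ψ => ∏ b : {a : α // x a = true},
    unitMatrix (ψ b) (y b.1) (z b.1) * unitMatrix (ψ b) (y (p b.1)) (z (p b.1)),
    ← Fintype.piFinset_univ, ← Finset.prod_univ_sum (fun _ : {a : α // x a = true} => Finset.univ)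
    fun b e => unitMatrix e (y b.1) (z b.1) * unitMatrix e (y (p b.1)) (z (p b.1))]
  simp_rw [sum_unitMatrix_mul_unitMatrix]
  have hcard : Fintype.card {a : α // x a = true} = Fintype.card α / 2 := by
    have h2 := Fintype.card_congr (pairingEquiv x hp xp)
    rw [Fintype.card_prod, Fintype.card_bool] at h2
    omega
  split_ifs with h
  · rw [reorient, sign_flipPairs hp _ _ xp, ← hcard, ← Finset.card_univ, ← Finset.prod_const]
    simp only [h.1 _, h.2 _, and_self, if_true]
    rw [Finset.prod_mul_distrib, mul_comm]
    congr 1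
    push_cast
    refine Finset.prod_congr rfl fun b _ => ?_
    split_ifs <;> simp
  · obtain ⟨a, ha⟩ : ∃ a, ¬ (y (p a) = (!y a) ∧ z (p a) = (!z a)) := by
      by_contra! hc
      exact h ⟨fun a => (hc a).1, fun a => (hc a).2⟩
    -- The failing pair is indexed by its representative in `{x}`, which is either `a` or `p a`.
    by_cases hxa : x a = true
    · exact Finset.prod_eq_zero (Finset.mem_univ ⟨a, hxa⟩) (if_neg ha)
    · refine Finset.prod_eq_zero (Finset.mem_univ ⟨p a, by simp [xp a, hxa]⟩) (if_neg ?_)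
      rw [hp.1]
      intro hc
      exact ha ⟨by rw [hc.1, Bool.not_not], by rw [hc.2, Bool.not_not]⟩

end Representation

section EulerCharacteristic

/-! ### The Euler characteristic of a bipartite Möbius graph -/

theorem cycleCount_comm {α : Type*} (p q : Equiv.Perm α) : cycleCount p q = cycleCount q p := by
  rw [cycleCount, cycleCount, Set.pair_comm]

theorem cycleCount_eq_of_card_invariant {α : Type*} [Finite α] {p q : Equiv.Perm α} {m : ℕ}
    (h : Nat.card {h : α → Bool // (∀ a, h (p a) = h a) ∧ ∀ a, h (q a) = h a} = 2 ^ m) :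
    cycleCount p q = m :=
  Nat.pow_right_injective le_rfl ((card_invariant p q).symm.trans h)

theorem cycleCount_sumCongr {α β : Type*} [Finite α] [Finite β] (p q : Equiv.Perm α)
    (p' q' : Equiv.Perm β) : cycleCount (Equiv.sumCongr p p') (Equiv.sumCongr q q') =
      cycleCount p q + cycleCount p' q' := by
  refine cycleCount_eq_of_card_invariant ?_
  rw [pow_add, ← card_invariant, ← card_invariant, ← Nat.card_prod]
  exact Nat.card_congr
    { toFun := fun h => (⟨fun a => h.1 (Sum.inl a), fun a => h.2.1 (Sum.inl a),
          fun a => h.2.2 (Sum.inl a)⟩,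
        ⟨fun a => h.1 (Sum.inr a), fun a => h.2.1 (Sum.inr a), fun a => h.2.2 (Sum.inr a)⟩)
      invFun := fun k => ⟨Sum.elim k.1.1 k.2.1, by
          rintro (a | a)
          exacts [k.1.2.1 a, k.2.2.1 a], by
          rintro (a | a)
          exacts [k.1.2.2 a, k.2.2.2 a]⟩
      left_inv := fun h => by ext (a | a) <;> rfl
      right_inv := fun k => rfl }

/-- Following the sides identifies the black and white copies of each label, so the two corner
pairings merge into one graph on the labels. With `σ` and `γ` this counts faces; with `δ` twice it
counts ribbons. -/
theorem cycleCount_sumComm {α : Type*} [Finite α] (p q : Equiv.Perm α) :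
    cycleCount (Equiv.sumComm α α) (Equiv.sumCongr p q) = cycleCount p q := by
  refine cycleCount_eq_of_card_invariant ?_
  rw [← card_invariant]
  exact Nat.card_congr
    { toFun := fun h => ⟨fun a => h.1 (Sum.inl a), fun a => h.2.2 (Sum.inl a), fun a => by
          change h.1 (Sum.inl (q a)) = h.1 (Sum.inl a)
          rw [← h.2.1 (Sum.inl (q a)), ← h.2.1 (Sum.inl a)]
          exact h.2.2 (Sum.inr a)⟩
      invFun := fun k => ⟨Sum.elim k.1 k.1, by rintro (a | a) <;> rfl, by
          rintro (a | a)
          exacts [k.2.1 a, k.2.2 a]⟩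
      left_inv := fun h => by
        ext (a | a)
        · rfl
        · exact h.2.1 (Sum.inr a)
      right_inv := fun k => rfl }

theorem cycleCount_delta_self (n : ℕ) : cycleCount (deltaPairing n) (deltaPairing n) = n := by
  refine cycleCount_eq_of_card_invariant ?_
  have : (2 : ℕ) ^ n = Nat.card (Fin n → Bool) := by simp
  rw [this]
  exact Nat.card_congr
    { toFun := fun h i => h.1 (i, true)
      invFun := fun k => ⟨fun a => k a.1, fun a => rfl, fun a => rfl⟩
      left_inv := fun h => by
        ext ⟨i, _ | _⟩
        · exact h.2.1 (i, false)
        · rfl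
      right_inv := fun k => rfl }

theorem finRotate_mk_of_lt {d r : ℕ} (hr : r + 1 < d) :
    finRotate d ⟨r, r.lt_succ_self.trans hr⟩ = ⟨r + 1, hr⟩ := by
  obtain ⟨d, rfl⟩ : ∃ d', d = d' + 1 := ⟨d - 1, by omega⟩
  exact finRotate_of_lt (by omega)

theorem nextInBlock_embedding {n : ℕ} (c : Composition n) (k : Fin c.length)
    (r : Fin (c.blocksFun k)) :
    nextInBlock c (c.embedding k r) = c.embedding k (finRotate _ r) := by
  change nextInBlock c (c.blocksFinEquiv ⟨k, r⟩) = c.blocksFinEquiv ⟨k, finRotate _ r⟩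
  simp only [nextInBlock, Equiv.permCongr_apply, Equiv.symm_apply_apply,
      Equiv.sigmaCongrRight_apply]

theorem index_nextInBlock {n : ℕ} (c : Composition n) (i : Fin n) :
    c.index (nextInBlock c i) = c.index i := by
  conv_lhs => rw [← c.embedding_comp_inv i, nextInBlock_embedding, c.index_embedding]

/-- `δ` followed by `σ` steps through a block cyclically, so an invariant function is determined by
its values at the first elements of the blocks. -/
theorem cycleCount_delta_sigma {n : ℕ} (c : Composition n) :
    cycleCount (deltaPairing n) (sigmaPairing c) = c.length := by
  refine cycleCount_eq_of_card_invariant ?_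
  have : (2 : ℕ) ^ c.length = Nat.card (Fin c.length → Bool) := by simp
  rw [this]
  refine Nat.card_congr
    { toFun := fun h k => h.1 (c.embedding k ⟨0, c.one_le_blocksFun k⟩, true)
      invFun := fun g => ⟨fun a => g (c.index a.1), fun a => rfl, ?_⟩
      left_inv := fun h => ?_
      right_inv := fun g => ?_ }
  · rintro ⟨i, _ | _⟩
    · change g (c.index ((nextInBlock c).symm i)) = g (c.index i)
      rw [← index_nextInBlock, Equiv.apply_symm_apply]
    · exact congrArg g (index_nextInBlock c i)
  · have hδ : ∀ i, h.1 (i, false) = h.1 (i, true) := fun i => h.2.1 (i, true)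
    have hnext : ∀ i, h.1 (nextInBlock c i, true) = h.1 (i, true) := fun i =>
      (hδ _).symm.trans (h.2.2 (i, true))
    have hblock : ∀ (k : Fin c.length) (r : ℕ) (hr : r < c.blocksFun k),
        h.1 (c.embedding k ⟨r, hr⟩, true) =
          h.1 (c.embedding k ⟨0, c.one_le_blocksFun k⟩, true) := by
      intro k r
      induction r with
      | zero => intro _; rfl
      | succ r ih =>
        intro hr
        rw [← ih (by omega), ← finRotate_mk_of_lt hr, ← nextInBlock_embedding, hnext]
    have hmain : ∀ i, h.1 (c.embedding (c.index i) ⟨0, c.one_le_blocksFun _⟩, true) =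
        h.1 (i, true) := by
      intro i
      conv_rhs => rw [← c.embedding_comp_inv i]
      exact (hblock _ _ _).symm
    ext ⟨i, _ | _⟩
    · exact (hmain i).trans (hδ i).symm
    · exact hmain i
  · funext k
    simp only [c.index_embedding]

theorem eulerChar_bipartiteMobiusGraph {n : ℕ} (c : Composition n)
    {γ : Equiv.Perm (SignedIndex n)} (hγ : IsPairing γ) :
    (bipartiteMobiusGraph c γ hγ).eulerChar =
      c.length + cycleCount (deltaPairing n) γ - n + cycleCount (sigmaPairing c) γ := by
  simp only [MobiusGraph.eulerChar, MobiusGraph.v, MobiusGraph.e, MobiusGraph.f,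
    bipartiteMobiusGraph]
  rw [cycleCount_sumCongr, cycleCount_comm (Equiv.sumCongr _ _) (Equiv.sumComm _ _),
    cycleCount_sumComm, cycleCount_sumComm, cycleCount_delta_self, cycleCount_delta_sigma]
  push_cast
  ring

/-- Distinct `γ` give distinct graphs, because `γ` is read off from the corners at the white
vertices. The set of graphs therefore carries no hidden multiplicity. -/
theorem sum_bipartiteMobiusGraphs {n : ℕ} {ι M : Type*} [AddCommMonoid M] (c : Composition n)
    (t : SignedIndex n → ι)
    [Fintype {γ : Equiv.Perm (SignedIndex n) // IsPairing γ ∧ ∀ a, t (γ a) = t a}]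
    (F : MobiusGraph (Line n) → M) :
    ∑ Γ ∈ bipartiteMobiusGraphs c t, F Γ =
      ∑ γ : {γ : Equiv.Perm (SignedIndex n) // IsPairing γ ∧ ∀ a, t (γ a) = t a},
        F (bipartiteMobiusGraph c γ.1 γ.2.1) := by
  symm
  refine Finset.sum_bij (fun γ _ => bipartiteMobiusGraph c γ.1 γ.2.1) ?_ ?_ ?_ ?_
  · intro γ _
    rw [bipartiteMobiusGraphs, Set.Finite.mem_toFinset]
    exact ⟨γ.1, γ.2.1, γ.2.2, rfl⟩
  · intro γ _ γ' _ h
    ext1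
    ext1 a
    have h1 := congrArg (fun Γ => Γ.corner (Sum.inr a)) h
    exact Sum.inr_injective h1
  · intro Γ hΓ
    rw [bipartiteMobiusGraphs, Set.Finite.mem_toFinset] at hΓ
    obtain ⟨γ, hγ, ht, rfl⟩ := hΓ
    exact ⟨⟨γ, hγ, ht⟩, Finset.mem_univ _, rfl⟩
  · intro γ _
    rfl

end EulerCharacteristic

section Expansion

/-! ### The contribution of a pair partition -/

theorem sum_ite_alternates {α : Type*} [Fintype α] [DecidableEq α] {p q : Equiv.Perm α}
    (hp : IsPairing p) (hq : IsPairing q) [DecidablePred fun y : α → Bool => Alternates y p]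
    [DecidablePred fun y : α → Bool => Alternates y q] :
    ∑ y : {y : α → Bool // Alternates y p}, (if Alternates y.1 q then (1 : ℂ) else 0) =
      2 ^ cycleCount p q := by
  rw [Finset.sum_boole, ← Fintype.card_subtype, ← Nat.card_eq_fintype_card,
    Nat.card_congr (Equiv.subtypeSubtypeEquivSubtypeInter _ fun y => Alternates y q),
    card_alternates hp hq]
  push_cast
  rfl

/-- The reference orientation `x` marks the negative indices, one in each pair of `δ` and of `σ`.
Multiplying the comparison of `x` with `y` by that of `z` with `x` leaves the comparison of `y` with
`z`. -/
theorem prod_ite_xor_eq_sign {n : ℕ} (c : Composition n) {y z x : SignedIndex n → Bool}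
    (yδ : Alternates y (deltaPairing n)) (zσ : Alternates z (sigmaPairing c))
    (hx : ∀ a, x a = !a.2) (xδ : Alternates x (deltaPairing n))
    (xσ : Alternates x (sigmaPairing c)) :
    (∏ i, if xor (y (i, false)) (z (i, false)) then (-1 : ℤˣ) else 1) =
      Equiv.Perm.sign (reorient (isPairing_delta n) xδ yδ) *
        Equiv.Perm.sign (reorient (isPairing_sigma c) zσ xσ) := by
  rw [reorient, reorient, sign_flipPairs _ _ _ xδ, sign_flipPairs _ _ _ xσ,
    ← Finset.prod_mul_distrib]
  let E : Fin n ≃ {a : SignedIndex n // x a = true} :=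
    { toFun := fun i => ⟨(i, false), by simp [hx]⟩
      invFun := fun a => a.1.1
      left_inv := fun i => rfl
      right_inv := by
        rintro ⟨⟨i, b⟩, h⟩
        simp only [hx, Bool.not_eq_true'] at h
        subst h
        rfl }
  rw [← E.prod_comp]
  refine Finset.prod_congr rfl fun i _ => ?_
  simp only [E, Equiv.coe_fn_mk, hx]
  rcases y (i, false) with _ | _ <;> rcases z (i, false) with _ | _ <;> simp

/-- By `sign_reorient_mul` all nonzero terms have the same sign. The sum is this common term times
the numbers of admissible `y` and `z`, and the signs are absorbed into powers of `-2`. -/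
theorem sum_alternates_mul_sum_prod_unitMatrix {n : ℕ} (c : Composition n)
    {γ : Equiv.Perm (SignedIndex n)} (hγ : IsPairing γ) :
    ∑ y : {y : SignedIndex n → Bool // Alternates y (deltaPairing n)},
      ∑ z : {z : SignedIndex n → Bool // Alternates z (sigmaPairing c)},
        (∏ i, if xor (y.1 (i, false)) (z.1 (i, false)) then (-1 : ℂ) else 1) *
          ∑ φ : {φ : SignedIndex n → Fin 4 // ∀ a, φ (γ a) = φ a},
            ∏ a, unitMatrix (φ.1 a) (y.1 a) (z.1 a) =
      2 ^ n * (-1) ^ (n + c.length) *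
        ((-2) ^ cycleCount (deltaPairing n) γ * (-2) ^ cycleCount (sigmaPairing c) γ) := by
  let x : SignedIndex n → Bool := fun a => !a.2
  have xδ : Alternates x (deltaPairing n) := by rintro ⟨i, _ | _⟩ <;> rfl
  have xσ : Alternates x (sigmaPairing c) := by rintro ⟨i, _ | _⟩ <;> rfl
  have hcard : Fintype.card (SignedIndex n) / 2 = n := by simp
  have hcard' : Fintype.card {a : SignedIndex n // x a = false} = n := by
    have h1 := card_eq_two_mul_card_false xδ
    omega
  have hterm : ∀ (y : {y : SignedIndex n → Bool // Alternates y (deltaPairing n)})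
      (z : {z : SignedIndex n → Bool // Alternates z (sigmaPairing c)}),
      (∏ i, if xor (y.1 (i, false)) (z.1 (i, false)) then (-1 : ℂ) else 1) *
          ∑ φ : {φ : SignedIndex n → Fin 4 // ∀ a, φ (γ a) = φ a},
            ∏ a, unitMatrix (φ.1 a) (y.1 a) (z.1 a) =
      (2 ^ n * (-1) ^ (n + c.length) * ((-1) ^ cycleCount (deltaPairing n) γ *
        (-1) ^ cycleCount (sigmaPairing c) γ)) *
        ((if Alternates y.1 γ then 1 else 0) * if Alternates z.1 γ then 1 else 0) := by
    intro y z
    rw [sum_prod_unitMatrix hγ, hcard]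
    by_cases h : Alternates y.1 γ ∧ Alternates z.1 γ
    · rw [dif_pos h, if_pos h.1, if_pos h.2]
      have h1 := sign_reorient_mul (isPairing_delta n) hγ (isPairing_sigma c) xσ xδ y.2 h.1 h.2 z.2
      rw [hcard', mul_right_comm, ← prod_ite_xor_eq_sign c y.2 z.2 (fun _ => rfl) xδ xσ,
        cycleCount_comm (sigmaPairing c), cycleCount_delta_sigma, cycleCount_comm γ] at h1
      have h2 := congrArg (fun u : ℤˣ => ((u : ℤ) : ℂ)) h1
      have h3 : (((∏ i, if xor (y.1 (i, false)) (z.1 (i, false)) then (-1 : ℤˣ) else 1 : ℤˣ) : ℤ) : ℂ)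
          = ∏ i, if xor (y.1 (i, false)) (z.1 (i, false)) then (-1 : ℂ) else 1 := by
        push_cast
        refine Finset.prod_congr rfl fun i _ => ?_
        split_ifs <;> simp
      simp only [Units.val_mul, Int.cast_mul, h3] at h2
      rw [mul_left_comm, h2]
      push_cast
      ring
    · rw [dif_neg h]
      rw [not_and_or] at h
      rcases h with h | h <;> simp [h]
  simp_rw [hterm]
  simp_rw [← Finset.mul_sum]
  rw [← Finset.sum_mul, sum_ite_alternates (isPairing_delta n) hγ,
    sum_ite_alternates (isPairing_sigma c) hγ, neg_pow 2, neg_pow 2]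
  ring

/-- With `m = c.length`, the point is `2 ^ (n - m) * (-1) ^ (n + m) = (-2) ^ (n - m) = 4 ^ (n - m) *
(-2) ^ (m - n)`. The last factor supplies the black vertices and the ribbons of the Euler
characteristic. -/
theorem weight_eq {n : ℕ} (c : Composition n) {γ : Equiv.Perm (SignedIndex n)}
    (hγ : IsPairing γ) :
    (1 / 2 : ℂ) ^ c.length * (2 ^ n * (-1) ^ (n + c.length) *
        ((-2) ^ cycleCount (deltaPairing n) γ * (-2) ^ cycleCount (sigmaPairing c) γ)) =
      (4 : ℂ) ^ ((n : ℤ) - (c.length : ℤ)) * (-2) ^ (bipartiteMobiusGraph c γ hγ).eulerChar := by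
  rw [eulerChar_bipartiteMobiusGraph, zpow_sub₀ (by norm_num), zpow_add₀ (by norm_num),
    zpow_sub₀ (by norm_num), zpow_add₀ (by norm_num)]
  simp only [zpow_natCast]
  have h4 : ∀ k : ℕ, (4 : ℂ) ^ k = (-2) ^ k * (-2) ^ k := by
    intro k
    rw [← mul_pow]; norm_num
  have h2 : ∀ k : ℕ, (2 : ℂ) ^ k = (-1) ^ k * (-2) ^ k := by
    intro k
    rw [← mul_pow]; norm_num
  have h1 : ∀ k : ℕ, ((-1 : ℂ) ^ k) * (-1) ^ k = 1 := by
    intro k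
    rw [← mul_pow]; norm_num
  have h0 : ∀ k : ℕ, ((-2 : ℂ) ^ k) ≠ 0 := fun k => pow_ne_zero _ (by norm_num)
  have h0' : ∀ k : ℕ, ((-1 : ℂ) ^ k) ≠ 0 := fun k => pow_ne_zero _ (by norm_num)
  rw [one_div, inv_pow, h4, h4, h2 n, h2 c.length, pow_add]
  have e1 := h1 n
  have e0 := h0 n
  have e2 := h0 c.length
  have e3 := h0' c.length
  generalize (-1 : ℂ) ^ n = A at *
  generalize (-2 : ℂ) ^ n = B at *
  generalize (-1 : ℂ) ^ c.length = C at *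
  generalize (-2 : ℂ) ^ c.length = D at *
  field_simp
  linear_combination e1

theorem card_pairings_eq_sum {α β κ : Type*} [Finite α] (t : α → β) (φ : α → κ)
    [Fintype {γ : Equiv.Perm α // IsPairing γ ∧ ∀ a, t (γ a) = t a}]
    [∀ γ : Equiv.Perm α, Decidable (∀ a, φ (γ a) = φ a)] :
    (Nat.card {γ : Equiv.Perm α // IsPairing γ ∧ ∀ a, (t (γ a), φ (γ a)) = (t a, φ a)} : ℂ) =
      ∑ γ : {γ : Equiv.Perm α // IsPairing γ ∧ ∀ a, t (γ a) = t a},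
        if ∀ a, φ (γ.1 a) = φ a then 1 else 0 := by
  rw [Finset.sum_boole, ← Fintype.card_subtype, ← Nat.card_eq_fintype_card,
    Nat.card_congr (Equiv.subtypeSubtypeEquivSubtypeInter _
      fun γ : Equiv.Perm α => ∀ a, φ (γ a) = φ a)]
  congr 1
  refine Nat.card_congr (Equiv.subtypeEquivRight fun γ => ?_)
  simp only [Prod.mk.injEq, forall_and, and_assoc]

end Expansion

/-! ### The moment formula -/

theorem mainTheorem2 {Ω : Type*} [MeasurableSpace Ω] (μ : Measure Ω) [IsProbabilityMeasure μ]
    {n : ℕ} (c : Composition n)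
    (Z : Fin n → Ω → ℍ[ℝ]) (hZ : ∀ i, IsQuaternionGaussian (Z i) μ) (hind : iIndepFun Z μ)
    (t : SignedIndex n → Fin n) (X : SignedIndex n → Ω → ℍ[ℝ]) (hX : ∀ a, X a = Z (t a)) :
    Integrable (fun ω => ∏ k : Fin c.length,
      ((List.ofFn fun r : Fin (c.blocksFun k) =>
        star (X (c.embedding k r, false) ω) * X (c.embedding k r, true) ω).prod).re) μ ∧
    ∫ ω, ∏ k : Fin c.length,
      ((List.ofFn fun r : Fin (c.blocksFun k) =>
        star (X (c.embedding k r, false) ω) * X (c.embedding k r, true) ω).prod).re ∂μ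
      = (4 : ℝ) ^ ((n : ℤ) - (c.length : ℤ)) *
        ∑ Γ ∈ bipartiteMobiusGraphs c t, (-2 : ℝ) ^ Γ.eulerChar := by
  classical
  -- The integrand is a polynomial in the real coordinates: `φ` selects a coordinate of each factor,
  -- `P φ` is the resulting monomial and `C φ` its complex coefficient.
  let C : (SignedIndex n → Fin 4) → ℂ := fun φ =>
    (1 / 2) ^ c.length * ∑ y : {y : SignedIndex n → Bool // Alternates y (deltaPairing n)},
      ∑ z : {z : SignedIndex n → Bool // Alternates z (sigmaPairing c)},
        (∏ i, if xor (y.1 (i, false)) (z.1 (i, false)) then (-1 : ℂ) else 1) *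
          ∏ a, unitMatrix (φ a) (y.1 a) (z.1 a)
  let P : (SignedIndex n → Fin 4) → Ω → ℝ := fun φ ω =>
    ∏ a, quaternionCoord (Z (t a) ω) (φ a)
  have hexp : ∀ ω, ((∏ k : Fin c.length, ((List.ofFn fun r : Fin (c.blocksFun k) =>
        star (X (c.embedding k r, false) ω) * X (c.embedding k r, true) ω).prod).re : ℝ) : ℂ) =
      ∑ φ, C φ * (P φ ω : ℂ) := by
    intro ω
    rw [prod_re_eq_sum_alternates c fun a => X a ω]
    have h1 : ∀ y z : SignedIndex n → Bool, ∏ a, quaternionMatrix (X a ω) (y a) (z a) =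
        ∑ φ : SignedIndex n → Fin 4, (P φ ω : ℂ) * ∏ a, unitMatrix (φ a) (y a) (z a) := by
      intro y z
      simp_rw [hX, quaternionMatrix_eq_sum]
      rw [Finset.prod_univ_sum, Fintype.piFinset_univ]
      refine Finset.sum_congr rfl fun φ _ => ?_
      rw [Finset.prod_mul_distrib, Complex.ofReal_prod]
    simp_rw [h1, C, Finset.mul_sum, Finset.sum_mul]
    conv_lhs => enter [2, y]; rw [Finset.sum_comm]
    rw [Finset.sum_comm]
    refine Finset.sum_congr rfl fun φ _ => Finset.sum_congr rfl fun y _ =>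
      Finset.sum_congr rfl fun z _ => ?_
    ring
  have hPint : ∀ φ, Integrable (P φ) μ := fun φ =>
    integrable_prod_quaternionCoord hZ fun a => (t a, φ a)
  have hCint : ∀ φ, Integrable (fun ω => C φ * (P φ ω : ℂ)) μ := fun φ =>
    (hPint φ).ofReal.const_mul _
  have hint : Integrable (fun ω => ((∏ k : Fin c.length,
      ((List.ofFn fun r : Fin (c.blocksFun k) =>
        star (X (c.embedding k r, false) ω) * X (c.embedding k r, true) ω).prod).re : ℝ) : ℂ)) μ := by
    simp_rw [hexp]
    exact integrable_finsetSum _ fun φ _ => hCint φ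
  refine ⟨hint.re, ?_⟩
  apply Complex.ofReal_injective
  rw [← integral_complex_ofReal]
  simp_rw [hexp]
  rw [integral_finsetSum _ fun φ _ => hCint φ]
  simp_rw [integral_const_mul, integral_complex_ofReal]
  have hP : ∀ φ, ((∫ ω, P φ ω ∂μ : ℝ) : ℂ) =
      ∑ γ : {γ : Equiv.Perm (SignedIndex n) // IsPairing γ ∧ ∀ a, t (γ a) = t a},
        if ∀ a, φ (γ.1 a) = φ a then 1 else 0 := by
    intro φ
    have h1 := integral_prod_quaternionCoord hZ hind fun a => (t a, φ a)
    rw [← card_pairings_eq_sum, ← Complex.ofReal_natCast, ← h1]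
  simp_rw [hP, Finset.mul_sum]
  rw [Finset.sum_comm, sum_bipartiteMobiusGraphs]
  push_cast
  refine Finset.sum_congr rfl fun γ _ => ?_
  rw [← weight_eq, ← sum_alternates_mul_sum_prod_unitMatrix c γ.2.1]
  simp_rw [mul_ite, mul_one, mul_zero]
  -- For fixed `γ`, only the coordinate choices that are constant on its pairs survive, which is the
  -- sum evaluated by the completeness relation.
  rw [← Finset.sum_filter, Finset.sum_subtype (p := fun φ : SignedIndex n → Fin 4 =>
    ∀ a, φ (γ.1 a) = φ a) _ (by simp)]
  simp_rw [C, ← Finset.mul_sum]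
  congr 1
  rw [Finset.sum_comm]
  refine Finset.sum_congr rfl fun y _ => ?_
  rw [Finset.sum_comm]
  refine Finset.sum_congr rfl fun z _ => ?_
  rw [Finset.mul_sum]
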